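/- Let $N$ be a finite set. For $A\subseteq N$ let $\delta_A:2^N\to\mathbb Z$ be the indicator function of the single point $A$. For distinct $a,b\in N$ and $C\subseteq N\setminus\{a,b\}$, the elementary imset $u_{\langle a,b|C\rangle}$ is $$u_{\langle a,b|C\rangle}=\delta_{\{a,b\}\cup C}+\delta_C-\delta_{\{a\}\cup C}-\delta_{\{b\}\cup C};$$ we write $xC$ for $\{x\}\cup C$. A $k$ by $m$ relation is an equality $\alpha_1u_1+\dots+\alpha_ku_k=\beta_1v_1+\dots+\beta_mv_m$ in which $u_1,\dots,u_k,v_1,\dots,v_m$ are pairwise distinct elementary imsets over $N$ and all $\alpha_i,\beta_j$ are positive integers. A relation contains another relation $\alpha'_1u'_1+\dots+\alpha'_{k'}u'_{k'}=\beta'_1v'_1+\dots+\beta'_{m'}v'_{m'}$ if every $u'_{i'}$ is among the $u_i$, or every $v'_{j'}$ is among the $v_j$. The order of the terms on each side of a relation is disregarded. Theorem. Consider a relation with three elementary imsets on the left-hand side, $$\alpha_1u_1+\alpha_2u_2+\alpha_3u_3=\beta_1v_1+\dots+\beta_mv_m .$$ Then one of the following two properties holds. (1) $m=3$, $\alpha_1=\alpha_2=\alpha_3=\beta_1=\beta_2=\beta_3$,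 and the relation is a positive multiple of $$u_{\langle a,b_1|b_2C\rangle}+u_{\langle a,b_2|b_3C\rangle}+u_{\langle a,b_3|b_1C\rangle}=u_{\langle a,b_2|b_1C\rangle}+u_{\langle a,b_3|b_2C\rangle}+u_{\langle a,b_1|b_3C\rangle}$$ for some distinct $a,b_1,b_2,b_3\in N$ and some $C\subseteq N\setminus\{a,b_1,b_2,b_3\}$. (2) The relation contains a positive multiple of a 2 by 2 relation $$u_{\langle a,b_1|C\rangle}+u_{\langle a,b_2|b_1C\rangle}=u_{\langle a,b_2|C\rangle}+u_{\langle a,b_1|b_2C\rangle}$$ with distinct $a,b_1,b_2\in N$ and $C\subseteq N\setminus\{a,b_1,b_2\}$. -/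

import Mathlib

/-- The indicator `δ_A` of a subset `A` of `N`, as an integer vector indexed by the subsets of `N`. -/
def deltaImset {N : Type*} [DecidableEq N] (A : Finset N) : Finset N → ℤ :=
  fun S => if S = A then 1 else 0

/-- The semi-elementary imset `u_⟨A,B|C⟩ = δ_{A ∪ B ∪ C} + δ_C - δ_{A ∪ C} - δ_{B ∪ C}`. -/
def semiElementaryImset {N : Type*} [DecidableEq N] (A B C : Finset N) : Finset N → ℤ :=
  deltaImset (A ∪ B ∪ C) + deltaImset C - deltaImset (A ∪ C) - deltaImset (B ∪ C)

/-- The imset `u_⟨a,b|C⟩` for singletons `{a}` and `{b}`. -/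
def elementaryImset {N : Type*} [DecidableEq N] (a b : N) (C : Finset N) : Finset N → ℤ :=
  semiElementaryImset {a} {b} C

/-- `u` is an elementary imset over `N`: `u = u_⟨a,b|C⟩` with `{a}`, `{b}`, `C` pairwise disjoint. -/
def IsElementaryImset {N : Type*} [DecidableEq N] (u : Finset N → ℤ) : Prop :=
  ∃ (a b : N) (C : Finset N), a ≠ b ∧ a ∉ C ∧ b ∉ C ∧ u = elementaryImset a b C

/-- A `k` by `m` relation `α₁ u₁ + ⋯ + α_k u_k = β₁ v₁ + ⋯ + β_m v_m` among elementary imsets, with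
positive integer coefficients and with `u₁, …, u_k, v₁, …, v_m` all distinct. -/
structure ImsetRelation (N : Type*) [DecidableEq N] (k m : ℕ) where
  α : Fin k → ℤ
  u : Fin k → Finset N → ℤ
  β : Fin m → ℤ
  v : Fin m → Finset N → ℤ
  α_pos : ∀ i, 0 < α i
  β_pos : ∀ j, 0 < β j
  u_elementary : ∀ i, IsElementaryImset (u i)
  v_elementary : ∀ j, IsElementaryImset (v j)
  u_injective : Function.Injective u
  v_injective : Function.Injective v
  u_ne_v : ∀ i j, u i ≠ v j
  sum_eq : ∑ i, α i • u i = ∑ j, β j • v j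

namespace ImsetRelation

/-- The vector `z` of a relation, indexed by imsets: it is `α i` at `u i`, `-β j` at `v j`, and zero
at all other imsets. -/
noncomputable def move {N : Type*} [DecidableEq N] {k m : ℕ} (R : ImsetRelation N k m) :
    (Finset N → ℤ) →₀ ℤ :=
  ∑ i, Finsupp.single (R.u i) (R.α i) - ∑ j, Finsupp.single (R.v j) (R.β j)

/-- `R` contains `R'` if every term on the left-hand side of `R'` appears on the left-hand side of
`R`, or every term on the right-hand side of `R'` appears on the right-hand side of `R`. -/
def Contains {N : Type*} [DecidableEq N] {k m k' m' : ℕ} (R : ImsetRelation N k m)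
    (R' : ImsetRelation N k' m') : Prop :=
  (∀ i', ∃ i, R.u i = R'.u i') ∨ (∀ j', ∃ j, R.v j = R'.v j')

/-- `R` is a positive multiple of a 2 by 2 relation
`u_⟨a,b₁|C⟩ + u_⟨a,b₂|b₁C⟩ = u_⟨a,b₂|C⟩ + u_⟨a,b₁|b₂C⟩`. -/
def IsMultipleOfTwoByTwo {N : Type*} [DecidableEq N] {k m : ℕ} (R : ImsetRelation N k m) : Prop :=
  ∃ (a b₁ b₂ : N) (C : Finset N),
    (a ≠ b₁ ∧ a ≠ b₂ ∧ b₁ ≠ b₂) ∧ (a ∉ C ∧ b₁ ∉ C ∧ b₂ ∉ C) ∧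
    ∃ c : ℤ, 0 < c ∧
      R.move = c •
        (Finsupp.single (elementaryImset a b₁ C) 1
          + Finsupp.single (elementaryImset a b₂ (insert b₁ C)) 1
          - Finsupp.single (elementaryImset a b₂ C) 1
          - Finsupp.single (elementaryImset a b₁ (insert b₂ C)) 1)

/-- `R` is a positive multiple of a 3 by 3 relation
`u_⟨a,b₁|b₂C⟩ + u_⟨a,b₂|b₃C⟩ + u_⟨a,b₃|b₁C⟩ = u_⟨a,b₂|b₁C⟩ + u_⟨a,b₃|b₂C⟩ + u_⟨a,b₁|b₃C⟩`. -/
def IsMultipleOfThreeByThree {N : Type*} [DecidableEq N] {k m : ℕ} (R : ImsetRelation N k m) :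
    Prop :=
  ∃ (a b₁ b₂ b₃ : N) (C : Finset N),
    (a ≠ b₁ ∧ a ≠ b₂ ∧ a ≠ b₃ ∧ b₁ ≠ b₂ ∧ b₁ ≠ b₃ ∧ b₂ ≠ b₃) ∧
    (a ∉ C ∧ b₁ ∉ C ∧ b₂ ∉ C ∧ b₃ ∉ C) ∧
    ∃ c : ℤ, 0 < c ∧
      R.move = c •
        (Finsupp.single (elementaryImset a b₁ (insert b₂ C)) 1
          + Finsupp.single (elementaryImset a b₂ (insert b₃ C)) 1
          + Finsupp.single (elementaryImset a b₃ (insert b₁ C)) 1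
          - Finsupp.single (elementaryImset a b₂ (insert b₁ C)) 1
          - Finsupp.single (elementaryImset a b₃ (insert b₂ C)) 1
          - Finsupp.single (elementaryImset a b₁ (insert b₃ C)) 1)

end ImsetRelation

/-! An elementary imset is a square in the Boolean lattice, given by a pair `p` of directions and a
top set `T ⊇ p`. Only the square with top `A ∪ p` among those with pair `p` sees `A`, so a relation
says that at every `A` the signed coefficients of these squares, one for each pair, sum to zero.
Toggling a direction of `p` in `A` flips the sign of that pair's term. Adding the equations at
suitable sets therefore eliminates some pairs and constrains the support of another. Summing a
relation over the supersets of a pair `q` counts the coefficients of the squares with pair `q`, so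
every pair on the right occurs on the left (`exists_pair_eq`). Three terms on the left thus leave at
most three pairs. Fewer than three is impossible: a single pair admits no relation, and
`false_of_two_pairs` excludes two. With three distinct pairs, each pair has exactly one positive
coefficient. None can be disjoint from both others (`false_of_isolated`), so some pair meets both.
If it meets them at different ends, two left-hand squares are stacked (`stacked_of_path`), and
stacked squares are a side of a 2 by 2 relation (`exists_twoByTwo`). If all three share a point `a`,
the equations split into classes modulo the other three directions. When no two squares are stacked,
a finite integer system (`star_integer_solution`) leaves only the multiples of the cyclic solution
in each class, and uniqueness of the positive coefficient leaves a single class. -/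

/-! ### Signed combinations of squares and their behaviour under flips -/

/-- The signed value at `A` of a combination of squares with common pair of directions `p`. -/
def squareTerm {N : Type*} [DecidableEq N] (p : Finset N) (c : Finset N → ℤ) (A : Finset N) : ℤ :=
  (-1) ^ (p \ A).card * c (A ∪ p)

section squareTerm

variable {N : Type*} [DecidableEq N]

lemma squareTerm_of_subset {p A : Finset N} (c : Finset N → ℤ) (h : p ⊆ A) :
    squareTerm p c A = c A := by
  simp [squareTerm, Finset.sdiff_eq_empty_iff_subset.2 h, Finset.union_eq_left.2 h]

/-- Toggling a direction of `p` moves to another corner of the same square, of opposite sign. All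
later cancellations come from this. -/
lemma squareTerm_insert {p A : Finset N} {x : N} (c : Finset N → ℤ) (hp : x ∈ p) (hA : x ∉ A) :
    squareTerm p c (insert x A) = -squareTerm p c A := by
  have h1 : insert x A ∪ p = A ∪ p := by
    rw [Finset.insert_union, Finset.insert_eq_of_mem (Finset.mem_union_right _ hp)]
  have h2 : p \ A = insert x (p \ insert x A) := by
    ext y; by_cases hy : y = x <;> simp_all
  have h3 : x ∉ p \ insert x A := by simp
  rw [squareTerm, squareTerm, h1, h2, Finset.card_insert_of_notMem h3, pow_succ]
  ring

lemma squareTerm_pair {a b : N} {A : Finset N} (c : Finset N → ℤ) (ha : a ∈ A) (hb : b ∉ A) :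
    squareTerm {a, b} c A = -c (insert b A) := by
  have := squareTerm_insert (p := {a, b}) c (by simp : b ∈ ({a, b} : Finset N)) hb
  rw [squareTerm_of_subset] at this
  · linarith
  · intro y; simp; rintro (rfl | rfl) <;> simp [ha]

/-- If two squares' directions flip under `x` and `y`, a combination with a unique positive
coefficient is supported on a single class modulo `{x, y}`. -/
lemma support_of_unique_pos {c r s : Finset N → ℤ} {p T₁ : Finset N} {x y : N}
    (hx : x ∉ p) (hy : y ∉ p) (hr : ∀ A, x ∉ A → r (insert x A) = -r A)
    (hs : ∀ A, y ∉ A → s (insert y A) = -s A) (h : ∀ A, p ⊆ A → c A + r A + s A = 0)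
    (hsupp : ∀ T, c T ≠ 0 → p ⊆ T) (hpos : ∀ T, 0 < c T ↔ T = T₁) :
    (∀ T, c T ≠ 0 → T \ {x, y} = T₁ \ {x, y}) ∧ ∃ W, W ≠ T₁ ∧ c W ≠ 0 := by
  -- In the sum of the equations at all `A ∪ K`, the `r`-terms cancel along `x` and the `s`-terms
  -- along `y`. If `x = y`, the two equations at `A` and `insert x A` suffice.
  have key : ∀ A, p ⊆ A → x ∉ A → y ∉ A →
      ∑ K ∈ ({x, y} : Finset N).powerset, c (A ∪ K) = 0 := by
    intro A hA hxA hyA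
    have e0 := h A hA
    have ex := h (insert x A) (hA.trans (Finset.subset_insert _ _))
    have rx := hr A hxA
    have ux : A ∪ {x} = insert x A := by ext; simp
    by_cases hxy : x = y
    · subst hxy
      have sx := hs A hxA
      have : (({x, x} : Finset N)).powerset = {∅, {x}} := by
        rw [Finset.pair_eq_singleton]; exact Finset.powerset_insert ∅ x
      rw [this, Finset.sum_pair (by simp), ux, Finset.union_empty]
      linarith
    · have ey := h (insert y A) (hA.trans (Finset.subset_insert _ _))
      have exy := h (insert y (insert x A))
        (hA.trans ((Finset.subset_insert _ _).trans (Finset.subset_insert _ _)))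
      have hyx : y ∉ insert x A := by simp [hyA, Ne.symm hxy]
      have hxy' : x ∉ insert y A := by simp [hxA, hxy]
      have rxy := hr _ hxy'
      have sxy := hs _ hyx
      have sy := hs _ hyA
      rw [Finset.insert_comm] at rxy
      have uy : A ∪ {y} = insert y A := by ext; simp
      have uxy : A ∪ {x, y} = insert y (insert x A) := by ext; simp; tauto
      rw [Finset.sum_powerset_insert (by simpa using hxy)]
      have : (({y} : Finset N)).powerset = {∅, {y}} := Finset.powerset_insert ∅ y
      rw [this, Finset.sum_pair (by simp), Finset.sum_pair (by simp)]
      rw [Finset.union_empty, uy, uxy, show insert x (∅ : Finset N) = {x} from rfl, ux]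
      linarith
  have hsd : ∀ T, p ⊆ T → p ⊆ T \ {x, y} := by
    intro T hT z hz
    simp only [Finset.mem_sdiff, hT hz, true_and, Finset.mem_insert, Finset.mem_singleton]
    rintro (rfl | rfl) <;> contradiction
  have hun : ∀ T : Finset N, T \ {x, y} ∪ T ∩ {x, y} = T := fun T => by
    ext z; simp; tauto
  constructor
  · intro T hT
    by_contra hne
    have hk := key (T \ {x, y}) (hsd T (hsupp T hT)) (by simp) (by simp)
    -- A class avoiding `T₁` has only nonpositive coefficients; as they sum to zero, all vanish.
    have hle : ∀ K ∈ ({x, y} : Finset N).powerset, c (T \ {x, y} ∪ K) ≤ 0 := by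
      intro K hK
      by_contra hlt
      have := (hpos _).1 (not_le.1 hlt)
      apply hne
      rw [← this]
      have hK' := Finset.mem_powerset.1 hK
      ext z
      have := @hK' z
      simp at this ⊢; tauto
    have := (Finset.sum_eq_zero_iff_of_nonpos hle).1 hk (T ∩ {x, y})
      (Finset.mem_powerset.2 Finset.inter_subset_right)
    rw [hun] at this
    exact hT this
  -- If `T₁` were alone in its class, the class sum would be `c T₁ > 0`.
  · by_contra! hall
    have hT₁ := (hpos T₁).2 rfl
    have hk := key (T₁ \ {x, y}) (hsd T₁ (hsupp T₁ hT₁.ne')) (by simp) (by simp)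
    rw [Finset.sum_eq_single (T₁ ∩ {x, y})] at hk
    · rw [hun] at hk; omega
    · intro K hK hne
      apply hall
      intro heq
      apply hne
      have hK' := Finset.mem_powerset.1 hK
      rw [← heq]
      ext z
      have := @hK' z
      simp at this ⊢; tauto
    · intro hn
      exact absurd (Finset.mem_powerset.2 Finset.inter_subset_right) hn

/-- A fiber of `c` over a flip `x` sums to zero. -/
lemma add_insert_eq_zero {c r s : Finset N → ℤ} {p A : Finset N} {x : N}
    (hr : ∀ A, x ∉ A → r (insert x A) = -r A) (hs : ∀ A, x ∉ A → s (insert x A) = -s A)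
    (h : ∀ A, p ⊆ A → c A + r A + s A = 0) (hA : p ⊆ A) (hx : x ∉ A) :
    c A + c (insert x A) = 0 := by
  have := h A hA
  have := h _ (hA.trans (Finset.subset_insert x A))
  have := hr A hx
  have := hs A hx
  omega

lemma exists_mem_sdiff_of_card_eq {p q : Finset N} (h : p.card = q.card) (hne : p ≠ q) :
    ∃ x ∈ p, x ∉ q := by
  by_contra! hcon
  exact hne (Finset.eq_of_subset_of_card_le hcon h.ge)

/-! ### Configurations of pairs that cannot occur -/

/-- Two pairs of directions cannot carry a relation with exactly one positive coefficient on one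
pair and at least two on the other. -/
lemma false_of_two_pairs {p q T₁ T₂ T₃ : Finset N} {c d : Finset N → ℤ}
    (hp : p.card = 2) (hq : q.card = 2) (hpq : p ≠ q)
    (h : ∀ A, squareTerm p c A + squareTerm q d A = 0)
    (hc : ∀ T, c T ≠ 0 → p ⊆ T) (hd : ∀ T, d T ≠ 0 → q ⊆ T)
    (hpos : ∀ T, 0 < c T ↔ T = T₁) (h₂ : 0 < d T₂) (h₃ : 0 < d T₃) (hne : T₂ ≠ T₃) : False := by
  have hp' : ∀ A, p ⊆ A → c A + squareTerm q d A + 0 = 0 := fun A hA => by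
    rw [← squareTerm_of_subset c hA, add_zero]; exact h A
  have hq' : ∀ A, q ⊆ A → d A + squareTerm p c A + 0 = 0 := fun A hA => by
    rw [← squareTerm_of_subset d hA, add_zero, add_comm]; exact h A
  have cls : ∀ x ∈ q, x ∉ p → (∀ T, c T ≠ 0 → T \ {x, x} = T₁ \ {x, x}) ∧ ∃ W, W ≠ T₁ ∧ c W ≠ 0 :=
    fun x hxq hxp => support_of_unique_pos (s := fun _ => 0) hxp hxp
      (fun A hA => squareTerm_insert d hxq hA) (by simp) hp' hc hpos
  obtain ⟨x, hxq, hxp⟩ := exists_mem_sdiff_of_card_eq (hq.trans hp.symm) hpq.symm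
  obtain ⟨y, hyp, hyq⟩ := exists_mem_sdiff_of_card_eq (hp.trans hq.symm) hpq
  obtain ⟨hx, W, hW, hcW⟩ := cls x hxq hxp
  -- A second element `z` of `q \ p` would make `W` agree with `T₁` both off `x` and off `z`,
  -- forcing `W = T₁`.
  have hxx : ∀ z ∈ q, z ∉ p → z = x := by
    intro z hzq hzp
    by_contra hzx
    have h1 := hx W hcW
    have h2 := (cls z hzq hzp).1 W hcW
    apply hW
    ext t
    have h1 := congrArg (t ∈ ·) h1
    have h2 := congrArg (t ∈ ·) h2
    simp at h1 h2
    by_cases htx : t = x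
    · subst htx; tauto
    · tauto
  have hcard : (p \ q).card = 1 := by
    have h1 : (q \ p).card = 1 := by
      rw [Finset.card_eq_one]
      refine ⟨x, ?_⟩
      ext z; simp; constructor
      · rintro ⟨h1, h2⟩; exact hxx z h1 h2
      · rintro rfl; exact ⟨hxq, hxp⟩
    have := Finset.card_sdiff_add_card_inter p q
    have := Finset.card_sdiff_add_card_inter q p
    rw [Finset.inter_comm] at this
    omega
  have hyy : ∀ z ∈ p, z ∉ q → z = y := by
    obtain ⟨w, hw⟩ := Finset.card_eq_one.1 hcard
    intro z hz hzq
    have h1 : z ∈ p \ q := by simp [hz, hzq]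
    have h2 : y ∈ p \ q := by simp [hyp, hyq]
    rw [hw] at h1 h2
    simp at h1 h2
    rw [h1, h2]
  have flip : ∀ A, q ⊆ A → y ∉ A → d A + d (insert y A) = 0 := fun A hA hy =>
    add_insert_eq_zero (s := fun _ => 0) (fun A hA => squareTerm_insert c hyp hA) (by simp) hq' hA hy
  have big : ∀ T, 0 < d T → d (insert y T) ≠ 0 := by
    intro T hT
    by_cases hyT : y ∈ T
    · rw [Finset.insert_eq_of_mem hyT]; exact hT.ne'
    · have := flip T (hd T hT.ne') hyT
      omega
  -- The set `insert y T` contains both pairs, so `c` equals `-d ≠ 0` there; the support of `c`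
  -- makes it agree with `T₁` off `x`, and it contains `x`.
  have eqT : ∀ T, 0 < d T → insert y T = insert x T₁ := by
    intro T hT
    have hqT := hd T hT.ne'
    have hpT : p ⊆ insert y T := by
      intro z hz
      by_cases hzq : z ∈ q
      · exact Finset.mem_insert_of_mem (hqT hzq)
      · rw [hyy z hz hzq]; simp
    have h1 := hp' (insert y T) hpT
    rw [squareTerm_of_subset _ (hqT.trans (Finset.subset_insert _ _))] at h1
    have h2 := hx (insert y T) (by have := big T hT; omega)
    have hxT : x ∈ insert y T := Finset.mem_insert_of_mem (hqT hxq)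
    ext t
    have h2 := congrArg (t ∈ ·) h2
    by_cases ht : t = x
    · subst ht; simp at hxT ⊢; exact hxT
    · simp [ht] at h2 ⊢; exact h2
  have h23 := (eqT T₂ h₂).trans (eqT T₃ h₃).symm
  have hq₂ := hd T₂ h₂.ne'
  have hq₃ := hd T₃ h₃.ne'
  -- `T₂` and `T₃` can differ only in `y`, but then `flip` gives `d` opposite signs at them.
  by_cases m2 : y ∈ T₂ <;> by_cases m3 : y ∈ T₃
  · rw [Finset.insert_eq_of_mem m2, Finset.insert_eq_of_mem m3] at h23; exact hne h23
  · have := flip T₃ hq₃ m3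
    rw [← h23, Finset.insert_eq_of_mem m2] at this
    omega
  · have := flip T₂ hq₂ m2
    rw [h23, Finset.insert_eq_of_mem m3] at this
    omega
  · apply hne
    have := congrArg (fun S => S.erase y) h23
    simpa [Finset.erase_insert m2, Finset.erase_insert m3] using this

/-- A pair of directions disjoint from two other distinct pairs cannot occur with a unique positive
coefficient. -/
lemma false_of_isolated {p₁ p₂ p₃ T₁ : Finset N} {c₁ c₂ c₃ : Finset N → ℤ}
    (hp₂ : p₂.card = 2) (hp₃ : p₃.card = 2) (h₁₂ : Disjoint p₁ p₂) (h₁₃ : Disjoint p₁ p₃)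
    (hne : p₂ ≠ p₃)
    (h : ∀ A, squareTerm p₁ c₁ A + squareTerm p₂ c₂ A + squareTerm p₃ c₃ A = 0)
    (hc : ∀ T, c₁ T ≠ 0 → p₁ ⊆ T) (hpos : ∀ T, 0 < c₁ T ↔ T = T₁) : False := by
  have cls : ∀ x ∈ p₂, ∀ y ∈ p₃, (∀ T, c₁ T ≠ 0 → T \ {x, y} = T₁ \ {x, y}) ∧
      ∃ W, W ≠ T₁ ∧ c₁ W ≠ 0 := fun x hx y hy =>
    support_of_unique_pos (Finset.disjoint_right.1 h₁₂ hx) (Finset.disjoint_right.1 h₁₃ hy)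
      (fun A hA => squareTerm_insert c₂ hx hA) (fun A hA => squareTerm_insert c₃ hy hA)
      (fun A hA => by rw [← squareTerm_of_subset c₁ hA]; exact h A) hc hpos
  -- The choices make `{x, y}` and `{x', y'}` disjoint (`x' = y'` is allowed), so agreement with
  -- `T₁` modulo each of them gives `W = T₁`.
  obtain ⟨x, hx2, hx3⟩ := exists_mem_sdiff_of_card_eq (hp₂.trans hp₃.symm) hne
  obtain ⟨y, hy3, hy2⟩ := exists_mem_sdiff_of_card_eq (hp₃.trans hp₂.symm) hne.symm
  obtain ⟨x', hx', hxx⟩ := Finset.exists_mem_ne (by omega : 1 < p₂.card) x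
  obtain ⟨y', hy', hyy⟩ := Finset.exists_mem_ne (by omega : 1 < p₃.card) y
  obtain ⟨h1, W, hW, hcW⟩ := cls x hx2 y hy3
  have h1 := h1 W hcW
  have h2 := (cls x' hx' y' hy').1 W hcW
  have hxy' : y' ≠ x := fun e => hx3 (e ▸ hy')
  have hyx' : x' ≠ y := fun e => hy2 (e ▸ hx')
  apply hW
  ext t
  have h1 := congrArg (t ∈ ·) h1
  have h2 := congrArg (t ∈ ·) h2
  by_cases htx : t = x
  · subst htx; simpa [hxx.symm, hxy'.symm] using h2
  · by_cases hty : t = y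
    · subst hty; simpa [hyy.symm, hyx'.symm] using h2
    · simpa [htx, hty] using h1

/-! ### Stacked squares and paths of pairs -/

/-- The squares with directions `p`, `q` and tops `S`, `T` form one side of a two by two relation. -/
def Stacked (p S q T : Finset N) : Prop :=
  ∃ a b c, a ≠ b ∧ a ≠ c ∧ b ≠ c ∧ p = {a, b} ∧ q = {a, c} ∧ p ⊆ S ∧ c ∉ S ∧ T = insert c S

/-- If the first pair meets the two others at its two different ends, two squares are stacked. -/
lemma stacked_of_path {a b x y : N} {T₁ T₂ T₃ : Finset N} {c₁ c₂ c₃ : Finset N → ℤ}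
    (hab : a ≠ b) (hax : a ≠ x) (hbx : b ≠ x) (hby : b ≠ y) (hay : a ≠ y)
    (h : ∀ A, squareTerm {a, b} c₁ A + squareTerm {a, x} c₂ A + squareTerm {b, y} c₃ A = 0)
    (hc₁ : ∀ T, c₁ T ≠ 0 → {a, b} ⊆ T) (hc₂ : ∀ T, c₂ T ≠ 0 → {a, x} ⊆ T)
    (hc₃ : ∀ T, c₃ T ≠ 0 → {b, y} ⊆ T)
    (hpos₁ : ∀ T, 0 < c₁ T ↔ T = T₁) (hpos₂ : ∀ T, 0 < c₂ T ↔ T = T₂)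
    (hpos₃ : ∀ T, 0 < c₃ T ↔ T = T₃) :
    (Stacked {a, b} T₁ {a, x} T₂ ∨ Stacked {a, x} T₂ {a, b} T₁) ∨
      (Stacked {a, b} T₁ {b, y} T₃ ∨ Stacked {b, y} T₃ {a, b} T₁) := by
  have main : ∀ (a b x y : N) (T₂ T₃ : Finset N) (c₂ c₃ : Finset N → ℤ), a ≠ b → a ≠ x → b ≠ x →
      (∀ A, squareTerm {a, b} c₁ A + squareTerm {a, x} c₂ A + squareTerm {b, y} c₃ A = 0) →
      ({a, b} ⊆ T₁) → (∀ T, c₂ T ≠ 0 → {a, x} ⊆ T) →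
      (∀ T, 0 < c₂ T ↔ T = T₂) → squareTerm {a, x} c₂ T₁ < 0 →
      Stacked {a, b} T₁ {a, x} T₂ ∨ Stacked {a, x} T₂ {a, b} T₁ := by
    intro a b x y T₂ T₃ c₂ c₃ hab hax hbx h hT₁ hc₂ hpos₂ hneg
    have haT : a ∈ T₁ := hT₁ (by simp)
    have hbT : b ∈ T₁ := hT₁ (by simp)
    -- If `x ∈ T₁`, then `c₂ T₁ < 0`; as `b` lies in both other pairs, flipping it gives `c₂
    -- (T₁.erase b) > 0`, which identifies `T₂`. Otherwise the negative term is `-c₂ (insert x T₁)`,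
    -- which identifies `T₂` directly.
    by_cases hxT : x ∈ T₁
    · right
      have hsub : ({a, x} : Finset N) ⊆ T₁ := by
        intro z; simp; rintro (rfl | rfl) <;> assumption
      rw [squareTerm_of_subset _ hsub] at hneg
      have hsub' : ({a, x} : Finset N) ⊆ T₁.erase b := by
        intro z; simp; rintro (rfl | rfl)
        · exact ⟨hab, haT⟩
        · exact ⟨hbx.symm, hxT⟩
      have := add_insert_eq_zero (p := {a, x}) (x := b) (A := T₁.erase b) (c := c₂)
        (fun A hA => squareTerm_insert (p := {a, b}) c₁ (by simp) hA)
        (fun A hA => squareTerm_insert (p := {b, y}) c₃ (by simp) hA)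
        (fun A hA => by
          rw [← squareTerm_of_subset c₂ hA]; linarith [h A]) hsub' (by simp)
      rw [Finset.insert_erase hbT] at this
      have hT₂ := (hpos₂ (T₁.erase b)).1 (by omega)
      subst hT₂
      exact ⟨a, x, b, hax, hab, hbx.symm, rfl, rfl, hsub', by simp, (Finset.insert_erase hbT).symm⟩
    · left
      rw [squareTerm_pair _ haT hxT] at hneg
      have hT₂ := (hpos₂ (insert x T₁)).1 (by omega)
      exact ⟨a, b, x, hab, hax, hbx, rfl, rfl, hT₁, hxT, hT₂.symm⟩
  have hT₁ := (hpos₁ T₁).2 rfl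
  have hs := hc₁ T₁ hT₁.ne'
  have h1 := h T₁
  rw [squareTerm_of_subset _ hs] at h1
  -- The positive `c₁ T₁` must be compensated by one of the two other pairs; `main` serves both ends
  -- of `{a, b}`.
  rcases (by omega : squareTerm {a, x} c₂ T₁ < 0 ∨ squareTerm {b, y} c₃ T₁ < 0) with h2 | h2
  · left
    exact main a b x y T₂ T₃ c₂ c₃ hab hax hbx h hs hc₂ hpos₂ h2
  · right
    have := main b a y x T₃ T₂ c₃ c₂ hab.symm hby hay
      (fun A => by rw [Finset.pair_comm b a]; linarith [h A]) (by rwa [Finset.pair_comm])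
      hc₃ hpos₃ h2
    rwa [Finset.pair_comm b a] at this

/-! ### Three pairs through a common point -/

set_option maxHeartbeats 2000000 in
-- The letters `x`, `y`, `z` are coefficients for the pairs `{a, b₁}`, `{a, b₂}`, `{a, b₃}`; the
-- index lists the further `bᵢ` in the top set. The equation at the set containing all three `bᵢ`
-- follows from the seven given. `hx`, `hy`, `hz` allow at most one positive coefficient per pair,
-- and `n1` to `n12` forbid the stacked positions. What survives is the one-parameter cyclic
-- solution.
lemma star_integer_solution {x0 x2 x3 x23 y0 y1 y3 y13 z0 z1 z2 z12 : ℤ}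
    (e0 : x0 + y0 + z0 = 0) (e1 : x0 - y1 - z1 = 0) (e2 : y0 - x2 - z2 = 0)
    (e3 : z0 - x3 - y3 = 0) (e12 : x2 + y1 - z12 = 0) (e13 : x3 + z1 - y13 = 0)
    (e23 : y3 + z2 - x23 = 0)
    (hx : (x0 ≤ 0 ∧ x2 ≤ 0 ∧ x3 ≤ 0 ∧ x23 ≤ 0) ∨ (0 < x0 ∧ x2 ≤ 0 ∧ x3 ≤ 0 ∧ x23 ≤ 0) ∨
      (x0 ≤ 0 ∧ 0 < x2 ∧ x3 ≤ 0 ∧ x23 ≤ 0) ∨ (x0 ≤ 0 ∧ x2 ≤ 0 ∧ 0 < x3 ∧ x23 ≤ 0) ∨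
      (x0 ≤ 0 ∧ x2 ≤ 0 ∧ x3 ≤ 0 ∧ 0 < x23))
    (hy : (y0 ≤ 0 ∧ y1 ≤ 0 ∧ y3 ≤ 0 ∧ y13 ≤ 0) ∨ (0 < y0 ∧ y1 ≤ 0 ∧ y3 ≤ 0 ∧ y13 ≤ 0) ∨
      (y0 ≤ 0 ∧ 0 < y1 ∧ y3 ≤ 0 ∧ y13 ≤ 0) ∨ (y0 ≤ 0 ∧ y1 ≤ 0 ∧ 0 < y3 ∧ y13 ≤ 0) ∨
      (y0 ≤ 0 ∧ y1 ≤ 0 ∧ y3 ≤ 0 ∧ 0 < y13))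
    (hz : (z0 ≤ 0 ∧ z1 ≤ 0 ∧ z2 ≤ 0 ∧ z12 ≤ 0) ∨ (0 < z0 ∧ z1 ≤ 0 ∧ z2 ≤ 0 ∧ z12 ≤ 0) ∨
      (z0 ≤ 0 ∧ 0 < z1 ∧ z2 ≤ 0 ∧ z12 ≤ 0) ∨ (z0 ≤ 0 ∧ z1 ≤ 0 ∧ 0 < z2 ∧ z12 ≤ 0) ∨
      (z0 ≤ 0 ∧ z1 ≤ 0 ∧ z2 ≤ 0 ∧ 0 < z12))
    (n1 : ¬(0 < x0 ∧ 0 < y1)) (n2 : ¬(0 < x0 ∧ 0 < z1)) (n3 : ¬(0 < x3 ∧ 0 < y13))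
    (n4 : ¬(0 < x2 ∧ 0 < z12)) (n5 : ¬(0 < y0 ∧ 0 < x2)) (n6 : ¬(0 < y0 ∧ 0 < z2))
    (n7 : ¬(0 < y3 ∧ 0 < x23)) (n8 : ¬(0 < y1 ∧ 0 < z12)) (n9 : ¬(0 < z0 ∧ 0 < x3))
    (n10 : ¬(0 < z0 ∧ 0 < y3)) (n11 : ¬(0 < z2 ∧ 0 < x23)) (n12 : ¬(0 < z1 ∧ 0 < y13)) :
    x0 = 0 ∧ x23 = 0 ∧ y0 = 0 ∧ y13 = 0 ∧ z0 = 0 ∧ z12 = 0 ∧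
      x3 = -x2 ∧ y3 = x2 ∧ y1 = -x2 ∧ z1 = x2 ∧ z2 = -x2 := by
  have P : ∀ {p q : Prop}, ¬(p ∧ q) → p → q → False := fun h hp hq => h ⟨hp, hq⟩
  rcases hx with ⟨_, _, _, _⟩ | ⟨_, _, _, _⟩ | ⟨_, _, _, _⟩ | ⟨_, _, _, _⟩ | ⟨_, _, _, _⟩ <;>
  rcases hy with ⟨_, _, _, _⟩ | ⟨_, _, _, _⟩ | ⟨_, _, _, _⟩ | ⟨_, _, _, _⟩ | ⟨_, _, _, _⟩ <;>
  rcases hz with ⟨_, _, _, _⟩ | ⟨_, _, _, _⟩ | ⟨_, _, _, _⟩ | ⟨_, _, _, _⟩ | ⟨_, _, _, _⟩ <;>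
  first
  | exact (P n1 ‹_› ‹_›).elim
  | exact (P n2 ‹_› ‹_›).elim
  | exact (P n3 ‹_› ‹_›).elim
  | exact (P n4 ‹_› ‹_›).elim
  | exact (P n5 ‹_› ‹_›).elim
  | exact (P n6 ‹_› ‹_›).elim
  | exact (P n7 ‹_› ‹_›).elim
  | exact (P n8 ‹_› ‹_›).elim
  | exact (P n9 ‹_› ‹_›).elim
  | exact (P n10 ‹_› ‹_›).elim
  | exact (P n11 ‹_› ‹_›).elim
  | exact (P n12 ‹_› ‹_›).elim
  | (clear n1 n2 n3 n4 n5 n6 n7 n8 n9 n10 n11 n12 P; exfalso; omega)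
  | (clear n1 n2 n3 n4 n5 n6 n7 n8 n9 n10 n11 n12 P;
     refine ⟨?_, ?_, ?_, ?_, ?_, ?_, ?_, ?_, ?_, ?_, ?_⟩ <;> omega)

end squareTerm

section star

variable {N : Type*} [DecidableEq N]

lemma insert_sdiff_three_cases {T : Finset N} {a b c : N} (hab : a ≠ b) (hac : a ≠ c) (hbc : b ≠ c)
    (ha : a ∈ T) : T = insert a (T \ {a, b, c}) ∨ T = insert a (insert b (T \ {a, b, c})) ∨
      T = insert a (insert c (T \ {a, b, c})) ∨
      T = insert a (insert b (insert c (T \ {a, b, c}))) := by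
  by_cases hb : b ∈ T <;> by_cases hc : c ∈ T
  · right; right; right
    ext t; by_cases h1 : t = a <;> by_cases h2 : t = b <;> by_cases h3 : t = c <;> simp_all
  · right; left
    ext t; by_cases h1 : t = a <;> by_cases h2 : t = b <;> by_cases h3 : t = c <;> simp_all
  · right; right; left
    ext t; by_cases h1 : t = a <;> by_cases h2 : t = b <;> by_cases h3 : t = c <;> simp_all
  · left
    ext t; by_cases h1 : t = a <;> by_cases h2 : t = b <;> by_cases h3 : t = c <;> simp_all

lemma pos_alternatives {X : Type*} {c : X → ℤ} {T S₀ S₁ S₂ S₃ : X} (hpos : ∀ S, 0 < c S ↔ S = T)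
    (h01 : S₀ ≠ S₁) (h02 : S₀ ≠ S₂) (h03 : S₀ ≠ S₃) (h12 : S₁ ≠ S₂) (h13 : S₁ ≠ S₃)
    (h23 : S₂ ≠ S₃) :
    (c S₀ ≤ 0 ∧ c S₁ ≤ 0 ∧ c S₂ ≤ 0 ∧ c S₃ ≤ 0) ∨ (0 < c S₀ ∧ c S₁ ≤ 0 ∧ c S₂ ≤ 0 ∧ c S₃ ≤ 0) ∨
      (c S₀ ≤ 0 ∧ 0 < c S₁ ∧ c S₂ ≤ 0 ∧ c S₃ ≤ 0) ∨ (c S₀ ≤ 0 ∧ c S₁ ≤ 0 ∧ 0 < c S₂ ∧ c S₃ ≤ 0) ∨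
      (c S₀ ≤ 0 ∧ c S₁ ≤ 0 ∧ c S₂ ≤ 0 ∧ 0 < c S₃) := by
  simp only [← not_lt, hpos]
  by_cases e0 : S₀ = T
  · subst e0; simp [h01.symm, h02.symm, h03.symm]
  by_cases e1 : S₁ = T
  · subst e1; simp [h01, h12.symm, h13.symm]
  by_cases e2 : S₂ = T
  · subst e2; simp [h02, h12, h23.symm]
  by_cases e3 : S₃ = T
  · subst e3; simp [h03, h13, h23]
  simp [e0, e1, e2, e3]

lemma insert_insert_sdiff_eq {F : Finset N} {a b c x y : N} (ha : a ∉ F) (hb : b ∉ F) (hc : c ∉ F)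
    (hx : x ∈ ({a, b, c} : Finset N)) (hy : y ∈ ({a, b, c} : Finset N)) :
    insert x (insert y F) \ {a, b, c} = F := by
  rw [Finset.insert_sdiff_of_mem _ hx, Finset.insert_sdiff_of_mem _ hy]
  exact Finset.sdiff_eq_self_of_disjoint (by simp [ha, hb, hc])

/-- In each class modulo `{b₁, b₂, b₃}` the coefficients of three pairwise unstacked squares with pairs
`{a, bᵢ}` are determined by a single integer. -/
lemma star_class_solution {a b₁ b₂ b₃ : N} {T₁ T₂ T₃ : Finset N} {c₁ c₂ c₃ : Finset N → ℤ}
    (ha1 : a ≠ b₁) (ha2 : a ≠ b₂) (ha3 : a ≠ b₃) (h12 : b₁ ≠ b₂) (h13 : b₁ ≠ b₃) (h23 : b₂ ≠ b₃)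
    (h : ∀ A, squareTerm {a, b₁} c₁ A + squareTerm {a, b₂} c₂ A + squareTerm {a, b₃} c₃ A = 0)
    (hpos₁ : ∀ T, 0 < c₁ T ↔ T = T₁) (hpos₂ : ∀ T, 0 < c₂ T ↔ T = T₂)
    (hpos₃ : ∀ T, 0 < c₃ T ↔ T = T₃)
    (n12 : ¬Stacked {a, b₁} T₁ {a, b₂} T₂) (n21 : ¬Stacked {a, b₂} T₂ {a, b₁} T₁)
    (n13 : ¬Stacked {a, b₁} T₁ {a, b₃} T₃) (n31 : ¬Stacked {a, b₃} T₃ {a, b₁} T₁)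
    (n23 : ¬Stacked {a, b₂} T₂ {a, b₃} T₃) (n32 : ¬Stacked {a, b₃} T₃ {a, b₂} T₂)
    {E : Finset N} (haE : a ∈ E) (h1E : b₁ ∉ E) (h2E : b₂ ∉ E) (h3E : b₃ ∉ E) :
    c₁ (insert b₁ E) = 0 ∧ c₁ (insert b₁ (insert b₂ (insert b₃ E))) = 0 ∧
    c₂ (insert b₂ E) = 0 ∧ c₂ (insert b₁ (insert b₂ (insert b₃ E))) = 0 ∧
    c₃ (insert b₃ E) = 0 ∧ c₃ (insert b₁ (insert b₂ (insert b₃ E))) = 0 ∧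
    c₁ (insert b₁ (insert b₃ E)) = -c₁ (insert b₁ (insert b₂ E)) ∧
    c₂ (insert b₂ (insert b₃ E)) = c₁ (insert b₁ (insert b₂ E)) ∧
    c₂ (insert b₁ (insert b₂ E)) = -c₁ (insert b₁ (insert b₂ E)) ∧
    c₃ (insert b₁ (insert b₃ E)) = c₁ (insert b₁ (insert b₂ E)) ∧
    c₃ (insert b₂ (insert b₃ E)) = -c₁ (insert b₁ (insert b₂ E)) := by
  have sub : ∀ {b : N} {A : Finset N}, a ∈ A → b ∈ A → ({a, b} : Finset N) ⊆ A := by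
    intro b A ha hb z; simp; rintro (rfl | rfl) <;> assumption
  have c21 : insert b₂ (insert b₁ E) = insert b₁ (insert b₂ E) := Finset.insert_comm _ _ _
  have c31 : insert b₃ (insert b₁ E) = insert b₁ (insert b₃ E) := Finset.insert_comm _ _ _
  have c32 : insert b₃ (insert b₂ E) = insert b₂ (insert b₃ E) := Finset.insert_comm _ _ _
  have c213 : insert b₂ (insert b₁ (insert b₃ E)) = insert b₁ (insert b₂ (insert b₃ E)) :=
    Finset.insert_comm _ _ _
  have c312 : insert b₃ (insert b₁ (insert b₂ E)) = insert b₁ (insert b₂ (insert b₃ E)) := by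
    rw [Finset.insert_comm b₃, c32]
  have e0 := h E
  rw [squareTerm_pair _ haE h1E, squareTerm_pair _ haE h2E, squareTerm_pair _ haE h3E] at e0
  have e1 := h (insert b₁ E)
  rw [squareTerm_of_subset _ (sub (by simp [haE]) (by simp)),
    squareTerm_pair _ (by simp [haE]) (by simp [h2E, h12.symm]),
    squareTerm_pair _ (by simp [haE]) (by simp [h3E, h13.symm]), c21, c31] at e1
  have e2 := h (insert b₂ E)
  rw [squareTerm_pair _ (by simp [haE]) (by simp [h1E, h12]),
    squareTerm_of_subset _ (sub (by simp [haE]) (by simp)),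
    squareTerm_pair _ (by simp [haE]) (by simp [h3E, h23.symm]), c32] at e2
  have e3 := h (insert b₃ E)
  rw [squareTerm_pair _ (by simp [haE]) (by simp [h1E, h13]),
    squareTerm_pair _ (by simp [haE]) (by simp [h2E, h23]),
    squareTerm_of_subset _ (sub (by simp [haE]) (by simp))] at e3
  have e12 := h (insert b₁ (insert b₂ E))
  rw [squareTerm_of_subset _ (sub (by simp [haE]) (by simp)),
    squareTerm_of_subset _ (sub (by simp [haE]) (by simp)),
    squareTerm_pair _ (by simp [haE]) (by simp [h3E, h23.symm, h13.symm]), c312] at e12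
  have e13 := h (insert b₁ (insert b₃ E))
  rw [squareTerm_of_subset _ (sub (by simp [haE]) (by simp)),
    squareTerm_pair _ (by simp [haE]) (by simp [h2E, h23, h12.symm]),
    squareTerm_of_subset _ (sub (by simp [haE]) (by simp)), c213] at e13
  have e23 := h (insert b₂ (insert b₃ E))
  rw [squareTerm_pair _ (by simp [haE]) (by simp [h1E, h12, h13]),
    squareTerm_of_subset _ (sub (by simp [haE]) (by simp)),
    squareTerm_of_subset _ (sub (by simp [haE]) (by simp))] at e23
  have ne : ∀ {S T : Finset N} (b : N), b ∈ T → b ∉ S → S ≠ T := by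
    rintro S _ b hT hS rfl; exact hS hT
  have st : ∀ {p S q T : Finset N} {b c : N}, ¬Stacked p S q T → a ≠ b → a ≠ c → b ≠ c →
      p = {a, b} → q = {a, c} → a ∈ S → b ∈ S → c ∉ S → T ≠ insert c S :=
    fun hn h1 h2 h3 hp hq h4 h5 h6 hT =>
      hn ⟨a, _, _, h1, h2, h3, hp, hq, hp ▸ sub h4 h5, h6, hT⟩
  refine star_integer_solution (by linarith) (by linarith) (by linarith) (by linarith)
    (by linarith) (by linarith) (by linarith)
    (pos_alternatives hpos₁ ?_ ?_ ?_ ?_ ?_ ?_) (pos_alternatives hpos₂ ?_ ?_ ?_ ?_ ?_ ?_)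
    (pos_alternatives hpos₃ ?_ ?_ ?_ ?_ ?_ ?_) ?_ ?_ ?_ ?_ ?_ ?_ ?_ ?_ ?_ ?_ ?_ ?_
  · exact ne b₂ (by simp) (by simp [*, Ne.symm])
  · exact ne b₃ (by simp) (by simp [*, Ne.symm])
  · exact ne b₃ (by simp) (by simp [*, Ne.symm])
  · exact ne b₃ (by simp) (by simp [*, Ne.symm])
  · exact ne b₃ (by simp) (by simp [*, Ne.symm])
  · exact ne b₂ (by simp) (by simp [*, Ne.symm])
  · exact ne b₁ (by simp) (by simp [*, Ne.symm])
  · exact ne b₃ (by simp) (by simp [*, Ne.symm])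
  · exact ne b₃ (by simp) (by simp [*, Ne.symm])
  · exact ne b₃ (by simp) (by simp [*, Ne.symm])
  · exact ne b₃ (by simp) (by simp [*, Ne.symm])
  · exact ne b₁ (by simp) (by simp [*, Ne.symm])
  · exact ne b₁ (by simp) (by simp [*, Ne.symm])
  · exact ne b₂ (by simp) (by simp [*, Ne.symm])
  · exact ne b₂ (by simp) (by simp [*, Ne.symm])
  · exact ne b₂ (by simp) (by simp [*, Ne.symm])
  · exact ne b₂ (by simp) (by simp [*, Ne.symm])
  · exact ne b₁ (by simp) (by simp [*, Ne.symm])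
  -- In the twelve remaining goals, positivity identifies the tops of two squares, and these would
  -- be stacked.
  all_goals
    simp only [hpos₁, hpos₂, hpos₃]
    rintro ⟨rfl, rfl⟩
  · exact st n12 ha1 ha2 h12 rfl rfl (by simp [haE]) (by simp) (by simp [*, Ne.symm]) c21.symm
  · exact st n13 ha1 ha3 h13 rfl rfl (by simp [haE]) (by simp) (by simp [*, Ne.symm]) c31.symm
  · exact st n12 ha1 ha2 h12 rfl rfl (by simp [haE]) (by simp) (by simp [*, Ne.symm]) c213.symm
  · exact st n13 ha1 ha3 h13 rfl rfl (by simp [haE]) (by simp) (by simp [*, Ne.symm]) c312.symm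
  · exact st n21 ha2 ha1 h12.symm rfl rfl (by simp [haE]) (by simp) (by simp [*, Ne.symm]) rfl
  · exact st n23 ha2 ha3 h23 rfl rfl (by simp [haE]) (by simp) (by simp [*, Ne.symm]) c32.symm
  · exact st n21 ha2 ha1 h12.symm rfl rfl (by simp [haE]) (by simp) (by simp [*, Ne.symm]) rfl
  · exact st n23 ha2 ha3 h23 rfl rfl (by simp [haE]) (by simp) (by simp [*, Ne.symm]) c312.symm
  · exact st n31 ha3 ha1 h13.symm rfl rfl (by simp [haE]) (by simp) (by simp [*, Ne.symm]) rfl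
  · exact st n32 ha3 ha2 h23.symm rfl rfl (by simp [haE]) (by simp) (by simp [*, Ne.symm]) rfl
  · exact st n31 ha3 ha1 h13.symm rfl rfl (by simp [haE]) (by simp) (by simp [*, Ne.symm]) rfl
  · exact st n32 ha3 ha2 h23.symm rfl rfl (by simp [haE]) (by simp) (by simp [*, Ne.symm]) c213.symm

/-- Three squares with pairs `{a, bᵢ}`, no two stacked, can only be the left-hand side of a cyclic
three by three relation. -/
lemma star_coefficients {a b₁ b₂ b₃ : N} {T₁ T₂ T₃ : Finset N} {c₁ c₂ c₃ : Finset N → ℤ}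
    (ha1 : a ≠ b₁) (ha2 : a ≠ b₂) (ha3 : a ≠ b₃) (h12 : b₁ ≠ b₂) (h13 : b₁ ≠ b₃) (h23 : b₂ ≠ b₃)
    (h : ∀ A, squareTerm {a, b₁} c₁ A + squareTerm {a, b₂} c₂ A + squareTerm {a, b₃} c₃ A = 0)
    (hc₁ : ∀ T, c₁ T ≠ 0 → {a, b₁} ⊆ T) (hc₂ : ∀ T, c₂ T ≠ 0 → {a, b₂} ⊆ T)
    (hc₃ : ∀ T, c₃ T ≠ 0 → {a, b₃} ⊆ T)
    (hpos₁ : ∀ T, 0 < c₁ T ↔ T = T₁) (hpos₂ : ∀ T, 0 < c₂ T ↔ T = T₂)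
    (hpos₃ : ∀ T, 0 < c₃ T ↔ T = T₃)
    (n12 : ¬Stacked {a, b₁} T₁ {a, b₂} T₂) (n21 : ¬Stacked {a, b₂} T₂ {a, b₁} T₁)
    (n13 : ¬Stacked {a, b₁} T₁ {a, b₃} T₃) (n31 : ¬Stacked {a, b₃} T₃ {a, b₁} T₁)
    (n23 : ¬Stacked {a, b₂} T₂ {a, b₃} T₃) (n32 : ¬Stacked {a, b₃} T₃ {a, b₂} T₂) :
    ∃ (E : Finset N) (s : ℤ), s ≠ 0 ∧ a ∈ E ∧ b₁ ∉ E ∧ b₂ ∉ E ∧ b₃ ∉ E ∧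
      (c₁ (insert b₁ (insert b₂ E)) = s ∧ c₁ (insert b₁ (insert b₃ E)) = -s ∧
        ∀ T, c₁ T ≠ 0 → T = insert b₁ (insert b₂ E) ∨ T = insert b₁ (insert b₃ E)) ∧
      (c₂ (insert b₂ (insert b₃ E)) = s ∧ c₂ (insert b₂ (insert b₁ E)) = -s ∧
        ∀ T, c₂ T ≠ 0 → T = insert b₂ (insert b₃ E) ∨ T = insert b₂ (insert b₁ E)) ∧
      (c₃ (insert b₃ (insert b₁ E)) = s ∧ c₃ (insert b₃ (insert b₂ E)) = -s ∧
        ∀ T, c₃ T ≠ 0 → T = insert b₃ (insert b₁ E) ∨ T = insert b₃ (insert b₂ E)) := by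
  have sol : ∀ E : Finset N, a ∈ E → b₁ ∉ E → b₂ ∉ E → b₃ ∉ E →
      c₁ (insert b₁ E) = 0 ∧ c₁ (insert b₁ (insert b₂ (insert b₃ E))) = 0 ∧
      c₂ (insert b₂ E) = 0 ∧ c₂ (insert b₁ (insert b₂ (insert b₃ E))) = 0 ∧
      c₃ (insert b₃ E) = 0 ∧ c₃ (insert b₁ (insert b₂ (insert b₃ E))) = 0 ∧
      c₁ (insert b₁ (insert b₃ E)) = -c₁ (insert b₁ (insert b₂ E)) ∧
      c₂ (insert b₂ (insert b₃ E)) = c₁ (insert b₁ (insert b₂ E)) ∧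
      c₂ (insert b₁ (insert b₂ E)) = -c₁ (insert b₁ (insert b₂ E)) ∧
      c₃ (insert b₁ (insert b₃ E)) = c₁ (insert b₁ (insert b₂ E)) ∧
      c₃ (insert b₂ (insert b₃ E)) = -c₁ (insert b₁ (insert b₂ E)) :=
    fun E haE h1E h2E h3E => star_class_solution ha1 ha2 ha3 h12 h13 h23 h hpos₁ hpos₂ hpos₃
      n12 n21 n13 n31 n23 n32 haE h1E h2E h3E
  have s12 : ∀ E : Finset N, insert b₂ (insert b₁ E) = insert b₁ (insert b₂ E) :=
    fun E => Finset.insert_comm _ _ _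
  have s13 : ∀ E : Finset N, insert b₃ (insert b₁ E) = insert b₁ (insert b₃ E) :=
    fun E => Finset.insert_comm _ _ _
  have s23 : ∀ E : Finset N, insert b₃ (insert b₂ E) = insert b₂ (insert b₃ E) :=
    fun E => Finset.insert_comm _ _ _
  have base : ∀ T : Finset N, a ∈ T → a ∈ T \ {b₁, b₂, b₃} ∧ b₁ ∉ T \ {b₁, b₂, b₃} ∧
      b₂ ∉ T \ {b₁, b₂, b₃} ∧ b₃ ∉ T \ {b₁, b₂, b₃} := by
    intro T hT; simp [hT, ha1, ha2, ha3]
  have p231 : ({b₂, b₁, b₃} : Finset N) = {b₁, b₂, b₃} := Finset.insert_comm _ _ _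
  have p312 : ({b₃, b₁, b₂} : Finset N) = {b₁, b₂, b₃} := by ext; simp; tauto
  have hT₁ := (hpos₁ T₁).2 rfl
  have hs := hc₁ T₁ hT₁.ne'
  obtain ⟨f1, f2, f3, f4⟩ := base T₁ (hs (by simp))
  obtain ⟨v1, v2, v3, v4, v5, v6, v7, v8, v9, v10, v11⟩ := sol _ f1 f2 f3 f4
  -- The coefficients of `c₁` at `b₁b₂F` and `b₁b₃F` are opposite, so if nonzero one is positive and
  -- its top is `T₁`. Hence only the class of `T₁` carries anything.
  have uniq : ∀ F : Finset N, a ∈ F → b₁ ∉ F → b₂ ∉ F → b₃ ∉ F →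
      c₁ (insert b₁ (insert b₂ F)) ≠ 0 → F = T₁ \ {b₁, b₂, b₃} := by
    intro F g1 g2 g3 g4 hne
    have w7 := (sol F g1 g2 g3 g4).2.2.2.2.2.2.1
    rcases lt_or_gt_of_ne hne with hlt | hgt
    · rw [← (hpos₁ (insert b₁ (insert b₃ F))).1 (by omega)]
      exact (insert_insert_sdiff_eq g2 g3 g4 (by simp) (by simp)).symm
    · rw [← (hpos₁ _).1 hgt]
      exact (insert_insert_sdiff_eq g2 g3 g4 (by simp) (by simp)).symm
  have supp₁ : ∀ T, c₁ T ≠ 0 → T = insert b₁ (insert b₂ (T₁ \ {b₁, b₂, b₃})) ∨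
      T = insert b₁ (insert b₃ (T₁ \ {b₁, b₂, b₃})) := by
    intro T hT
    obtain ⟨g1, g2, g3, g4⟩ := base T (hc₁ T hT (by simp))
    obtain ⟨w1, w2, w3, w4, w5, w6, w7, w8, w9, w10, w11⟩ := sol _ g1 g2 g3 g4
    have hu := uniq _ g1 g2 g3 g4
    rcases insert_sdiff_three_cases h12 h13 h23 (hc₁ T hT (by simp)) with e | e | e | e
    · rw [← e] at w1; exact absurd w1 hT
    · rw [← e] at hu; rw [← hu hT]; exact Or.inl e
    · rw [← e] at w7; rw [← hu (by omega)]; exact Or.inr e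
    · rw [← e] at w2; exact absurd w2 hT
  -- The parameter may have either sign: `T₁` is `b₁b₂E` if it is positive and `b₁b₃E` if it is
  -- negative.
  refine ⟨T₁ \ {b₁, b₂, b₃}, c₁ (insert b₁ (insert b₂ (T₁ \ {b₁, b₂, b₃}))), ?_, f1, f2, f3, f4,
    ⟨rfl, v7, supp₁⟩, ⟨v8, by rw [s12]; exact v9, ?_⟩,
    ⟨by rw [s13]; exact v10, by rw [s23]; exact v11, ?_⟩⟩
  · rcases supp₁ T₁ hT₁.ne' with e | e
    · rw [← e]; exact hT₁.ne'
    · rw [← e] at v7; omega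
  · intro T hT
    obtain ⟨g1, g2, g3, g4⟩ := base T (hc₂ T hT (by simp))
    obtain ⟨w1, w2, w3, w4, w5, w6, w7, w8, w9, w10, w11⟩ := sol _ g1 g2 g3 g4
    have hu := uniq _ g1 g2 g3 g4
    rcases insert_sdiff_three_cases h12.symm h23 h13 (hc₂ T hT (by simp)) with e | e | e | e <;>
      rw [p231] at e
    · rw [← e] at w3; exact absurd w3 hT
    · rw [s12] at e ⊢; rw [← e] at w9 hu; rw [← hu (by omega)]; exact Or.inr e
    · rw [← e] at w8; rw [← hu (by omega)]; exact Or.inl e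
    · rw [s12] at e; rw [← e] at w4; exact absurd w4 hT
  · intro T hT
    obtain ⟨g1, g2, g3, g4⟩ := base T (hc₃ T hT (by simp))
    obtain ⟨w1, w2, w3, w4, w5, w6, w7, w8, w9, w10, w11⟩ := sol _ g1 g2 g3 g4
    have hu := uniq _ g1 g2 g3 g4
    rcases insert_sdiff_three_cases h13.symm h23.symm h12 (hc₃ T hT (by simp)) with e | e | e | e <;>
      rw [p312] at e
    · rw [← e] at w5; exact absurd w5 hT
    · rw [s13] at e ⊢; rw [← e] at w10; rw [← hu (by omega)]; exact Or.inl e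
    · rw [s23] at e ⊢; rw [← e] at w11; rw [← hu (by omega)]; exact Or.inr e
    · rw [s13, s23] at e; rw [← e] at w6; exact absurd w6 hT

end star

/-! ### Elementary imsets as squares -/

/-- The elementary imset with pair of directions `p` and top set `T`, for `p ⊆ T`. -/
def squareImset {N : Type*} [DecidableEq N] (p T : Finset N) : Finset N → ℤ :=
  fun A => if A ∪ p = T then (-1) ^ (p \ A).card else 0

section squareImset

variable {N : Type*} [DecidableEq N]

/-- Both sides vanish at `A` unless `A` agrees with `C` off `a` and `b`; the four possibilities for
`A ∩ {a, b}` are then the corners of the square. -/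
lemma elementaryImset_eq_squareImset {a b : N} {C : Finset N} (hab : a ≠ b) (ha : a ∉ C)
    (hb : b ∉ C) : elementaryImset a b C = squareImset {a, b} (insert a (insert b C)) := by
  have key : ∀ A : Finset N, A ∪ {a, b} = insert a (insert b C) ↔
      ∀ t, t ≠ a → t ≠ b → (t ∈ A ↔ t ∈ C) := by
    intro A
    rw [Finset.ext_iff]
    refine forall_congr' fun t => ?_
    by_cases h1 : t = a <;> by_cases h2 : t = b <;> simp [h1, h2]
  have ext' : ∀ A B : Finset N, A = B ↔ (a ∈ A ↔ a ∈ B) ∧ (b ∈ A ↔ b ∈ B) ∧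
      ∀ t, t ≠ a → t ≠ b → (t ∈ A ↔ t ∈ B) := by
    intro A B
    rw [Finset.ext_iff]
    refine ⟨fun h => ⟨h a, h b, fun t _ _ => h t⟩, fun ⟨h1, h2, h3⟩ t => ?_⟩
    by_cases e1 : t = a
    · rw [e1]; exact h1
    by_cases e2 : t = b
    · rw [e2]; exact h2
    exact h3 t e1 e2
  have r : ∀ A : Finset N, (∀ t, t ≠ a → t ≠ b → (t ∈ A ↔ t ∈ ({a} ∪ {b} ∪ C : Finset N))) ↔
      ∀ t, t ≠ a → t ≠ b → (t ∈ A ↔ t ∈ C) := fun A =>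
    forall_congr' fun t => forall_congr' fun h1 => forall_congr' fun h2 => by simp [h1, h2]
  have r1 : ∀ A : Finset N, (∀ t, t ≠ a → t ≠ b → (t ∈ A ↔ t ∈ ({a} ∪ C : Finset N))) ↔
      ∀ t, t ≠ a → t ≠ b → (t ∈ A ↔ t ∈ C) := fun A =>
    forall_congr' fun t => forall_congr' fun h1 => forall_congr' fun h2 => by simp [h1]
  have r2 : ∀ A : Finset N, (∀ t, t ≠ a → t ≠ b → (t ∈ A ↔ t ∈ ({b} ∪ C : Finset N))) ↔
      ∀ t, t ≠ a → t ≠ b → (t ∈ A ↔ t ∈ C) := fun A =>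
    forall_congr' fun t => forall_congr' fun h1 => forall_congr' fun h2 => by simp [h2]
  funext A
  classical
  simp only [elementaryImset, semiElementaryImset, deltaImset, squareImset, Pi.add_apply,
    Pi.sub_apply, key]
  simp only [ext' A ({a} ∪ {b} ∪ C), ext' A C, ext' A ({a} ∪ C), ext' A ({b} ∪ C), r, r1, r2]
  by_cases hA : ∀ t, t ≠ a → t ≠ b → (t ∈ A ↔ t ∈ C)
  · have hba := hab.symm
    simp only [eq_true hA]
    by_cases h1 : a ∈ A <;> by_cases h2 : b ∈ A
    · have : ({a, b} : Finset N) \ A = ∅ := by ext; simp; rintro (rfl | rfl) <;> assumption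
      simp [h1, h2, ha, hb, hab, hba, this]
    · have : ({a, b} : Finset N) \ A = {b} := by
        ext t; simp; constructor
        · rintro ⟨rfl | rfl, h⟩ <;> simp_all
        · rintro rfl; simp [h2]
      simp [h1, h2, ha, hb, hab, hba, this]
    · have : ({a, b} : Finset N) \ A = {a} := by
        ext t; simp; constructor
        · rintro ⟨rfl | rfl, h⟩ <;> simp_all
        · rintro rfl; simp [h1]
      simp [h1, h2, ha, hb, hab, hba, this]
    · have : ({a, b} : Finset N) \ A = {a, b} := by
        ext t; simp; rintro (rfl | rfl) <;> assumption
      simp [h1, h2, ha, hb, hab, hba, this]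
  · simp [hA]

lemma isElementaryImset_iff {u : Finset N → ℤ} :
    IsElementaryImset u ↔ ∃ p T : Finset N, p.card = 2 ∧ p ⊆ T ∧ u = squareImset p T := by
  constructor
  · rintro ⟨a, b, C, hab, ha, hb, rfl⟩
    refine ⟨{a, b}, insert a (insert b C), Finset.card_pair hab, ?_,
      elementaryImset_eq_squareImset hab ha hb⟩
    intro t; simp; tauto
  · rintro ⟨p, T, hp, hpT, rfl⟩
    obtain ⟨a, b, hab, rfl⟩ := Finset.card_eq_two.1 hp
    refine ⟨a, b, T \ {a, b}, hab, by simp, by simp, ?_⟩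
    rw [elementaryImset_eq_squareImset hab (by simp) (by simp)]
    congr 1
    have h1 := hpT (by simp : a ∈ ({a, b} : Finset N))
    have h2 := hpT (by simp : b ∈ ({a, b} : Finset N))
    ext t; by_cases e1 : t = a <;> by_cases e2 : t = b <;> simp_all

lemma squareImset_eq_zero {p T : Finset N} (h : ¬p ⊆ T) : squareImset p T = 0 := by
  funext A
  have : A ∪ p ≠ T := by rintro rfl; exact h Finset.subset_union_right
  simp [squareImset, this]

/-- Pairing with the indicator of the supersets of a pair `q` detects the pair of directions. -/
lemma sum_superset_squareImset [Fintype N] {p q T : Finset N} (hp : p.card = 2) (hq : q.card = 2)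
    (hT : p ⊆ T) :
    ∑ A, (if q ⊆ A then squareImset p T A else 0) = if p = q then 1 else 0 := by
  split_ifs with hpq
  · subst hpq
    rw [Finset.sum_eq_single T]
    · simp [hT, squareImset, Finset.sdiff_eq_empty_iff_subset.2 hT]
    · intro A _ hA
      split_ifs with h
      · simp [squareImset, Finset.union_eq_left.2 h, hA]
      · rfl
    · simp
  · obtain ⟨x, hxp, hxq⟩ := exists_mem_sdiff_of_card_eq (hp.trans hq.symm) hpq
    have e : ∀ A, squareImset p T A = squareTerm p (fun S => if S = T then 1 else 0) A := by
      intro A; simp [squareImset, squareTerm]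
    -- Toggling `x ∈ p \ q` preserves `q ⊆ A` and reverses the sign, so the terms cancel in pairs.
    refine Finset.sum_involution (fun A _ => if x ∈ A then A.erase x else insert x A) ?_ ?_
      (fun _ _ => Finset.mem_univ _) ?_
    · intro A _
      by_cases hx : x ∈ A
      · have h1 := squareTerm_insert (fun S => if S = T then 1 else 0) hxp (Finset.notMem_erase x A)
        rw [Finset.insert_erase hx] at h1
        have h2 : q ⊆ A.erase x ↔ q ⊆ A := by
          rw [Finset.subset_erase]; simp [hxq]
        simp only [hx, if_true, h2, e, h1]
        split_ifs <;> simp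
      · have h1 := squareTerm_insert (fun S => if S = T then 1 else 0) hxp hx
        have h2 : q ⊆ insert x A ↔ q ⊆ A := Finset.subset_insert_iff_of_notMem hxq
        simp only [hx, if_false, h2, e, h1]
        split_ifs <;> simp
    · intro A _ _
      by_cases hx : x ∈ A
      · simp only [hx, if_true]; intro h; rw [← h] at hx; simp at hx
      · simp only [hx, if_false]; intro h; rw [← h] at hx; simp at hx
    · intro A _
      by_cases hx : x ∈ A <;> simp [hx]

/-- Pairing with the supersets of `p` recovers the directions; the value at `S` then recovers the
top. -/
lemma squareImset_injective [Finite N] {p q S T : Finset N} (hp : p.card = 2) (hq : q.card = 2)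
    (hS : p ⊆ S) (hT : q ⊆ T) (h : squareImset p S = squareImset q T) : p = q ∧ S = T := by
  cases nonempty_fintype N
  have h1 := sum_superset_squareImset hp hp hS
  have h2 := sum_superset_squareImset hq hp hT
  rw [h, h2] at h1
  have hpq : q = p := by by_contra hne; simp [hne] at h1
  subst hpq
  refine ⟨rfl, ?_⟩
  have := congrFun h S
  simp only [squareImset, Finset.union_eq_left.2 hS, if_true] at this
  by_contra hne
  simp [hne] at this

end squareImset

/-! ### Coefficient functions of a relation -/

namespace ImsetRelation

variable {N : Type*} [DecidableEq N] {k m : ℕ} (R : ImsetRelation N k m)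

lemma move_u (i : Fin k) : R.move (R.u i) = R.α i := by
  simp only [move, Finsupp.sub_apply, Finsupp.finsetSum_apply]
  rw [Finset.sum_eq_single i, Finset.sum_eq_zero]
  · simp
  · intro j _; exact Finsupp.single_eq_of_ne (R.u_ne_v i j)
  · intro j _ hj; exact Finsupp.single_eq_of_ne (R.u_injective.ne hj.symm)
  · simp

lemma move_v (j : Fin m) : R.move (R.v j) = -R.β j := by
  simp only [move, Finsupp.sub_apply, Finsupp.finsetSum_apply]
  rw [Finset.sum_eq_zero, Finset.sum_eq_single j]
  · simp
  · intro i _ hi; exact Finsupp.single_eq_of_ne (R.v_injective.ne hi.symm)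
  · simp
  · intro i _; exact Finsupp.single_eq_of_ne (R.u_ne_v i j).symm

lemma exists_of_move_ne_zero {w : Finset N → ℤ} (h : R.move w ≠ 0) :
    (∃ i, w = R.u i) ∨ ∃ j, w = R.v j := by
  by_contra! hcon
  apply h
  simp only [move, Finsupp.sub_apply, Finsupp.finsetSum_apply]
  rw [Finset.sum_eq_zero, Finset.sum_eq_zero, sub_zero]
  · intro j _; exact Finsupp.single_eq_of_ne (hcon.2 j)
  · intro i _; exact Finsupp.single_eq_of_ne (hcon.1 i)

lemma move_pos_iff {w : Finset N → ℤ} : 0 < R.move w ↔ ∃ i, w = R.u i := by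
  constructor
  · intro h
    rcases R.exists_of_move_ne_zero h.ne' with h1 | ⟨j, rfl⟩
    · exact h1
    · rw [move_v] at h; have := R.β_pos j; omega
  · rintro ⟨i, rfl⟩; rw [move_u]; exact R.α_pos i

lemma move_neg_iff {w : Finset N → ℤ} : R.move w < 0 ↔ ∃ j, w = R.v j := by
  constructor
  · intro h
    rcases R.exists_of_move_ne_zero h.ne with ⟨i, rfl⟩ | h1
    · rw [move_u] at h; have := R.α_pos i; omega
    · exact h1
  · rintro ⟨j, rfl⟩; rw [move_v]; have := R.β_pos j; omega

lemma isElementaryImset_of_move_ne_zero {w : Finset N → ℤ} (h : R.move w ≠ 0) :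
    IsElementaryImset w := by
  rcases R.exists_of_move_ne_zero h with ⟨i, rfl⟩ | ⟨j, rfl⟩
  · exact R.u_elementary i
  · exact R.v_elementary j

lemma sum_move_mul (A : Finset N) : ∑ w ∈ R.move.support, R.move w * w A = 0 := by
  have h : Finsupp.linearCombination ℤ (fun w : Finset N → ℤ => w A) R.move = 0 := by
    have := congrFun R.sum_eq A
    simp only [Finset.sum_apply, Pi.smul_apply] at this
    simp only [move, map_sub, map_sum, Finsupp.linearCombination_single]
    rw [this, sub_self]
  simpa [Finsupp.linearCombination_apply, Finsupp.sum] using h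

/-- For `p ⊄ T` the function `squareImset p T` is zero, whereas an elementary imset takes the value
1 at its top. -/
lemma zero_of_not_subset {p T : Finset N} (h : R.move (squareImset p T) ≠ 0) : p ⊆ T := by
  by_contra hn
  have hz := squareImset_eq_zero hn
  obtain ⟨q, S, _, hS, hw⟩ := isElementaryImset_iff.1 (R.isElementaryImset_of_move_ne_zero h)
  have := congrFun hw S
  rw [hz] at this
  simp [squareImset, Finset.union_eq_left.2 hS, Finset.sdiff_eq_empty_iff_subset.2 hS] at this

variable [Finite N]

/-- Every pair of directions on the right-hand side occurs on the left-hand side. -/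
lemma exists_pair_eq {p T : Fin k → Finset N} (hp : ∀ i, (p i).card = 2) (hT : ∀ i, p i ⊆ T i)
    (hu : ∀ i, R.u i = squareImset (p i) (T i)) {q W : Finset N} (hq : q.card = 2)
    (h : R.move (squareImset q W) ≠ 0) : ∃ i, p i = q := by
  cases nonempty_fintype N
  by_contra! hcon
  have hW := R.zero_of_not_subset h
  -- Summed over the supersets of `q`, a term contributes its coefficient exactly when its pair is
  -- `q`: nothing on the left, something positive on the right.
  have hL : ∑ A, (if q ⊆ A then (∑ i, R.α i • R.u i) A else 0) = 0 := by
    have : ∀ A, (if q ⊆ A then (∑ i, R.α i • R.u i) A else 0) =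
        ∑ i, R.α i * (if q ⊆ A then squareImset (p i) (T i) A else 0) := by
      intro A; split_ifs <;> simp [hu, Finset.sum_apply]
    simp_rw [this]
    rw [Finset.sum_comm]
    refine Finset.sum_eq_zero fun i _ => ?_
    rw [← Finset.mul_sum, sum_superset_squareImset (hp i) hq (hT i)]
    simp [hcon i]
  have hR : 0 < ∑ A, (if q ⊆ A then (∑ j, R.β j • R.v j) A else 0) := by
    have : ∀ A, (if q ⊆ A then (∑ j, R.β j • R.v j) A else 0) =
        ∑ j, R.β j * (if q ⊆ A then R.v j A else 0) := by
      intro A; split_ifs <;> simp [Finset.sum_apply]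
    simp_rw [this]
    rw [Finset.sum_comm]
    simp_rw [← Finset.mul_sum]
    have hj : ∀ j, (∑ A, if q ⊆ A then R.v j A else 0) = 0 ∨
        (∑ A, if q ⊆ A then R.v j A else 0) = 1 := by
      intro j
      obtain ⟨q', S, hq', hS, hw⟩ := isElementaryImset_iff.1 (R.v_elementary j)
      rw [hw, sum_superset_squareImset hq' hq hS]
      split_ifs <;> simp
    obtain ⟨j, hvj⟩ : ∃ j, squareImset q W = R.v j := by
      rcases R.exists_of_move_ne_zero h with ⟨i, hi⟩ | h
      · rw [hu] at hi
        exact absurd (squareImset_injective hq (hp i) hW (hT i) hi).1.symm (hcon i)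
      · exact h
    refine Finset.sum_pos' (fun j _ => ?_) ⟨j, Finset.mem_univ _, ?_⟩
    · have := R.β_pos j
      rcases hj j with e | e <;> rw [e] <;> omega
    · rw [← hvj, sum_superset_squareImset hq hq hW]
      simpa using R.β_pos j
  rw [← R.sum_eq, hL] at hR
  exact lt_irrefl _ hR

/-- A relation splits at every set `A` according to the pairs of directions. -/
lemma sum_squareTerm_eq_zero {P : Finset (Finset N)} (hP : ∀ p ∈ P, p.card = 2)
    (h : ∀ q W : Finset N, q.card = 2 → R.move (squareImset q W) ≠ 0 → q ∈ P) (A : Finset N) :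
    ∑ p ∈ P, squareTerm p (fun T => R.move (squareImset p T)) A = 0 := by
  classical
  rw [← R.sum_move_mul A]
  have inj : Set.InjOn (fun p => squareImset p (A ∪ p)) (P : Set (Finset N)) := by
    intro p hp q hq hpq
    exact (squareImset_injective (hP p hp) (hP q hq) Finset.subset_union_right
      Finset.subset_union_right hpq).1
  have e1 : ∑ p ∈ P, squareTerm p (fun T => R.move (squareImset p T)) A =
      ∑ w ∈ P.image (fun p => squareImset p (A ∪ p)), R.move w * w A := by
    rw [Finset.sum_image inj]
    refine Finset.sum_congr rfl fun p _ => ?_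
    simp [squareTerm, squareImset, mul_comm]
  rw [e1]
  -- Both sums extend to the union of their index sets: a supported imset outside the image vanishes
  -- at `A`, and an image element outside the support has coefficient zero.
  have s1 := Finset.sum_subset (f := fun w => R.move w * w A)
    (Finset.subset_union_left (s₁ := P.image (fun p => squareImset p (A ∪ p)))
      (s₂ := R.move.support)) (by
      intro w hw hn
      rcases Finset.mem_union.1 hw with hw | hw
      · exact absurd hw hn
      have hw := Finsupp.mem_support_iff.1 hw
      obtain ⟨q, S, hq, hS, rfl⟩ := isElementaryImset_iff.1 (R.isElementaryImset_of_move_ne_zero hw)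
      have hqP := h q S hq hw
      have : A ∪ q ≠ S := by
        rintro rfl
        exact hn (Finset.mem_image.2 ⟨q, hqP, rfl⟩)
      simp [squareImset, this])
  have s2 := Finset.sum_subset (f := fun w => R.move w * w A)
    (Finset.subset_union_right (s₁ := P.image (fun p => squareImset p (A ∪ p)))
      (s₂ := R.move.support)) (by
      intro w _ hn
      rw [Finsupp.notMem_support_iff.1 hn, zero_mul])
  rw [s1, s2]

end ImsetRelation

/-! ### The 2 by 2 and 3 by 3 relations -/

/-- Both sides equal the semi-elementary imset `u_⟨a,bc|C⟩`, which is symmetric in `b` and `c`. -/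
lemma elementaryImset_add_elementaryImset {N : Type*} [DecidableEq N] (a b c : N) (C : Finset N) :
    elementaryImset a b C + elementaryImset a c (insert b C) =
      elementaryImset a c C + elementaryImset a b (insert c C) := by
  simp only [elementaryImset, semiElementaryImset]
  have h1 : ∀ x, {a} ∪ {x} ∪ C = {a} ∪ insert x C := fun x => by
    rw [Finset.union_assoc, ← Finset.insert_eq x]
  have h2 : {a} ∪ {c} ∪ insert b C = {a} ∪ {b} ∪ insert c C := by
    rw [Finset.union_assoc, Finset.union_assoc, ← Finset.insert_eq c, ← Finset.insert_eq b,
      Finset.insert_comm]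
  have h3 : {c} ∪ insert b C = {b} ∪ insert c C := by
    rw [← Finset.insert_eq, ← Finset.insert_eq, Finset.insert_comm]
  rw [h1, h1, h2, h3, ← Finset.insert_eq b C, ← Finset.insert_eq c C]
  abel

namespace ImsetRelation

variable {N : Type*} [DecidableEq N] [Finite N]

/-- Two stacked squares form the left-hand side of a two by two relation. -/
lemma exists_twoByTwo {a b c : N} {S : Finset N} (hab : a ≠ b) (hac : a ≠ c) (hbc : b ≠ c)
    (ha : a ∈ S) (hb : b ∈ S) (hc : c ∉ S) :
    ∃ R : ImsetRelation N 2 2, R.IsMultipleOfTwoByTwo ∧ R.u 0 = squareImset {a, b} S ∧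
      R.u 1 = squareImset {a, c} (insert c S) := by
  obtain ⟨C, haC, hbC, rfl⟩ : ∃ C, a ∉ C ∧ b ∉ C ∧ S = insert a (insert b C) := by
    refine ⟨S \ {a, b}, by simp, by simp, ?_⟩
    ext t; by_cases h1 : t = a <;> by_cases h2 : t = b <;> simp_all
  have hcC : c ∉ C := fun h => hc (by simp [h])
  have e1 := elementaryImset_eq_squareImset hab haC hbC
  have e2 : elementaryImset a c (insert b C) =
      squareImset {a, c} (insert c (insert a (insert b C))) := by
    rw [elementaryImset_eq_squareImset hac (by simp [hab, haC]) (by simp [hbc.symm, hcC]),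
      Finset.insert_comm]
  have e3 := elementaryImset_eq_squareImset hac haC hcC
  have e4 := elementaryImset_eq_squareImset (C := insert c C) hab (by simp [hac, haC])
    (by simp [hbc, hbC])
  have inj : ∀ {x y : N} {S T : Finset N}, a ≠ x → a ≠ y → a ∈ S → x ∈ S → a ∈ T → y ∈ T →
      squareImset {a, x} S = squareImset {a, y} T → ({a, x} : Finset N) = {a, y} ∧ S = T := by
    intro x y S T hax hay h1 h2 h3 h4 h
    refine squareImset_injective (Finset.card_pair hax) (Finset.card_pair hay) ?_ ?_ h
    · intro t; simp; rintro (rfl | rfl) <;> assumption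
    · intro t; simp; rintro (rfl | rfl) <;> assumption
  have hne : ({a, b} : Finset N) ≠ {a, c} := by
    intro h
    have : b ∈ ({a, c} : Finset N) := h ▸ (by simp)
    simp at this
    rcases this with h | h
    · exact hab h.symm
    · exact hbc h
  have n12 : elementaryImset a b C ≠ elementaryImset a c (insert b C) := by
    rw [e1, e2]; intro h
    exact hne (inj hab hac (by simp) (by simp) (by simp) (by simp) h).1
  have n34 : elementaryImset a c C ≠ elementaryImset a b (insert c C) := by
    rw [e3, e4]; intro h
    exact hne (inj hac hab (by simp) (by simp) (by simp) (by simp) h).1.symm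
  have n13 : elementaryImset a b C ≠ elementaryImset a c C := by
    rw [e1, e3]; intro h
    exact hne (inj hab hac (by simp) (by simp) (by simp) (by simp) h).1
  have n24 : elementaryImset a c (insert b C) ≠ elementaryImset a b (insert c C) := by
    rw [e2, e4]; intro h
    exact hne (inj hac hab (by simp) (by simp) (by simp) (by simp) h).1.symm
  have n14 : elementaryImset a b C ≠ elementaryImset a b (insert c C) := by
    rw [e1, e4]; intro h
    have := (inj hab hab (by simp) (by simp) (by simp) (by simp) h).2
    exact hc (this ▸ by simp)
  have n23 : elementaryImset a c (insert b C) ≠ elementaryImset a c C := by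
    rw [e2, e3]; intro h
    have := (inj hac hac (by simp) (by simp) (by simp) (by simp) h).2
    have hb' : b ∈ insert a (insert c C) := this ▸ by simp
    simp [hab.symm, hbc, hbC] at hb'
  refine ⟨{ α := fun _ => 1
            u := ![elementaryImset a b C, elementaryImset a c (insert b C)]
            β := fun _ => 1
            v := ![elementaryImset a c C, elementaryImset a b (insert c C)]
            α_pos := fun _ => one_pos
            β_pos := fun _ => one_pos
            u_elementary := ?_
            v_elementary := ?_
            u_injective := ?_
            v_injective := ?_
            u_ne_v := ?_
            sum_eq := ?_ }, ?_, e1, e2⟩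
  · intro i; fin_cases i
    · exact ⟨a, b, C, hab, haC, hbC, rfl⟩
    · exact ⟨a, c, insert b C, hac, by simp [hab, haC], by simp [hbc.symm, hcC], rfl⟩
  · intro i; fin_cases i
    · exact ⟨a, c, C, hac, haC, hcC, rfl⟩
    · exact ⟨a, b, insert c C, hab, by simp [hac, haC], by simp [hbc, hbC], rfl⟩
  · intro i j h; fin_cases i <;> fin_cases j
    · rfl
    · exact absurd h n12
    · exact absurd h.symm n12
    · rfl
  · intro i j h; fin_cases i <;> fin_cases j
    · rfl
    · exact absurd h n34
    · exact absurd h.symm n34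
    · rfl
  · intro i j; fin_cases i <;> fin_cases j
    · exact n13
    · exact n14
    · exact n23
    · exact n24
  · simpa [Fin.sum_univ_two] using elementaryImset_add_elementaryImset a b c C
  · refine ⟨a, b, c, C, ⟨hab, hac, hbc⟩, ⟨haC, hbC, hcC⟩, 1, one_pos, ?_⟩
    simp only [move, Fin.sum_univ_two, one_smul, Matrix.cons_val_zero, Matrix.cons_val_one]
    abel

/-- A relation supported on the six imsets of a cyclic three by three relation, with opposite
constant coefficients on the two sides, is a multiple of it. -/
lemma threeByThree_of_move {k m : ℕ} (R : ImsetRelation N k m) {a b₁ b₂ b₃ : N} {E : Finset N}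
    {s : ℤ} (hs : 0 < s) (ha1 : a ≠ b₁) (ha2 : a ≠ b₂) (ha3 : a ≠ b₃) (h12 : b₁ ≠ b₂)
    (h13 : b₁ ≠ b₃) (h23 : b₂ ≠ b₃) (ha : a ∈ E) (h1 : b₁ ∉ E) (h2 : b₂ ∉ E) (h3 : b₃ ∉ E)
    (m1 : R.move (squareImset {a, b₁} (insert b₁ (insert b₂ E))) = s)
    (m2 : R.move (squareImset {a, b₂} (insert b₂ (insert b₃ E))) = s)
    (m3 : R.move (squareImset {a, b₃} (insert b₃ (insert b₁ E))) = s)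
    (m4 : R.move (squareImset {a, b₂} (insert b₂ (insert b₁ E))) = -s)
    (m5 : R.move (squareImset {a, b₃} (insert b₃ (insert b₂ E))) = -s)
    (m6 : R.move (squareImset {a, b₁} (insert b₁ (insert b₃ E))) = -s)
    (hw : ∀ w, R.move w ≠ 0 → w = squareImset {a, b₁} (insert b₁ (insert b₂ E)) ∨
      w = squareImset {a, b₂} (insert b₂ (insert b₃ E)) ∨
      w = squareImset {a, b₃} (insert b₃ (insert b₁ E)) ∨
      w = squareImset {a, b₂} (insert b₂ (insert b₁ E)) ∨
      w = squareImset {a, b₃} (insert b₃ (insert b₂ E)) ∨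
      w = squareImset {a, b₁} (insert b₁ (insert b₃ E))) :
    m = 3 ∧ (∃ c : ℤ, (∀ i, R.α i = c) ∧ (∀ j, R.β j = c)) ∧ R.IsMultipleOfThreeByThree := by
  classical
  have el : ∀ {x y : N}, a ≠ x → a ≠ y → x ≠ y → x ∉ E →
      elementaryImset a x (insert y (E.erase a)) = squareImset {a, x} (insert x (insert y E)) := by
    intro x y hax hay hxy hx
    rw [elementaryImset_eq_squareImset hax (by simp [hay]) (by simp [hxy, hx])]
    congr 1
    rw [Finset.insert_comm, Finset.insert_comm a y, Finset.insert_erase ha]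
  have ne : ∀ {x y : N} {S T : Finset N}, a ≠ x → a ≠ y → x ≠ y → a ∈ S → x ∈ S → a ∈ T → y ∈ T →
      squareImset {a, x} S ≠ squareImset {a, y} T := by
    intro x y S T hax hay hxy h1 h2 h3 h4 h
    have := (squareImset_injective (Finset.card_pair hax) (Finset.card_pair hay) (by
      intro t; simp; rintro (rfl | rfl) <;> assumption) (by
      intro t; simp; rintro (rfl | rfl) <;> assumption) h).1
    have hx : x ∈ ({a, y} : Finset N) := this ▸ (by simp)
    simp [hax.symm, hxy] at hx
  have d12 := ne (S := insert b₁ (insert b₂ E)) (T := insert b₂ (insert b₃ E)) ha1 ha2 h12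
    (by simp [ha]) (by simp) (by simp [ha]) (by simp)
  have d13 := ne (S := insert b₁ (insert b₂ E)) (T := insert b₃ (insert b₁ E)) ha1 ha3 h13
    (by simp [ha]) (by simp) (by simp [ha]) (by simp)
  have d23 := ne (S := insert b₂ (insert b₃ E)) (T := insert b₃ (insert b₁ E)) ha2 ha3 h23
    (by simp [ha]) (by simp) (by simp [ha]) (by simp)
  have d45 := ne (S := insert b₂ (insert b₁ E)) (T := insert b₃ (insert b₂ E)) ha2 ha3 h23
    (by simp [ha]) (by simp) (by simp [ha]) (by simp)
  have d64 := ne (S := insert b₁ (insert b₃ E)) (T := insert b₂ (insert b₁ E)) ha1 ha2 h12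
    (by simp [ha]) (by simp) (by simp [ha]) (by simp)
  have d65 := ne (S := insert b₁ (insert b₃ E)) (T := insert b₃ (insert b₂ E)) ha1 ha3 h13
    (by simp [ha]) (by simp) (by simp [ha]) (by simp)
  have three : R.IsMultipleOfThreeByThree := by
    refine ⟨a, b₁, b₂, b₃, E.erase a, ⟨ha1, ha2, ha3, h12, h13, h23⟩, ⟨by simp, by simp [h1],
      by simp [h2], by simp [h3]⟩, s, hs, ?_⟩
    rw [el ha1 ha2 h12 h1, el ha2 ha3 h23 h2, el ha3 ha1 h13.symm h3, el ha2 ha1 h12.symm h2,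
      el ha3 ha2 h23.symm h3, el ha1 ha3 h13 h1]
    -- From here only distinctness and coefficients matter: imsets on the same side differ by their
    -- pairs, those on opposite sides by the sign of their coefficients.
    generalize squareImset {a, b₁} (insert b₁ (insert b₂ E)) = w1 at *
    generalize squareImset {a, b₂} (insert b₂ (insert b₃ E)) = w2 at *
    generalize squareImset {a, b₃} (insert b₃ (insert b₁ E)) = w3 at *
    generalize squareImset {a, b₂} (insert b₂ (insert b₁ E)) = w4 at *
    generalize squareImset {a, b₃} (insert b₃ (insert b₂ E)) = w5 at *
    generalize squareImset {a, b₁} (insert b₁ (insert b₃ E)) = w6 at *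
    clear el ne
    have sep : ∀ {x y}, R.move x = s → R.move y = -s → x ≠ y := by
      rintro x _ hx hy rfl; omega
    have d14 := sep m1 m4
    have d15 := sep m1 m5
    have d16 := sep m1 m6
    have d24 := sep m2 m4
    have d25 := sep m2 m5
    have d26 := sep m2 m6
    have d34 := sep m3 m4
    have d35 := sep m3 m5
    have d36 := sep m3 m6
    clear sep
    ext w
    simp only [Finsupp.smul_apply, Finsupp.sub_apply, Finsupp.add_apply, Finsupp.single_apply,
      smul_eq_mul]
    by_cases h0 : R.move w = 0
    · have ne0 : ∀ {x}, (R.move x = s ∨ R.move x = -s) → x ≠ w := by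
        rintro x hx rfl; omega
      simp [h0, ne0 (Or.inl m1), ne0 (Or.inl m2), ne0 (Or.inl m3), ne0 (Or.inr m4),
        ne0 (Or.inr m5), ne0 (Or.inr m6)]
    · rcases hw w h0 with rfl | rfl | rfl | rfl | rfl | rfl
      · simp [m1, d12.symm, d13.symm, d14.symm, d15.symm, d16.symm]
      · simp [m2, d12, d23.symm, d24.symm, d25.symm, d26.symm]
      · simp [m3, d13, d23, d34.symm, d35.symm, d36.symm]
      · simp [m4, d14, d24, d34, d45.symm, d64]
      · simp [m5, d15, d25, d35, d45, d65]
      · simp [m6, d16, d26, d36, d64.symm, d65.symm]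
  have val : ∀ w, R.move w ≠ 0 → R.move w = s ∨ R.move w = -s := by
    intro w h0
    rcases hw w h0 with rfl | rfl | rfl | rfl | rfl | rfl <;> simp [*]
  have hβ : ∀ j, R.β j = s := by
    intro j
    have h := R.move_v j
    have hp := R.β_pos j
    have := val (R.v j) (by omega)
    omega
  refine ⟨?_, ⟨s, ?_, hβ⟩, three⟩
  -- The imsets with negative coefficient are exactly these three, and `v` is injective, so `m = 3`.
  · have himg : Finset.univ.image R.v = {squareImset {a, b₁} (insert b₁ (insert b₃ E)),
        squareImset {a, b₂} (insert b₂ (insert b₁ E)),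
        squareImset {a, b₃} (insert b₃ (insert b₂ E))} := by
      ext w
      simp only [Finset.mem_image, Finset.mem_univ, true_and, Finset.mem_insert,
        Finset.mem_singleton]
      have hneg := R.move_neg_iff (w := w)
      constructor
      · rintro ⟨j, hj⟩
        have hlt := hneg.2 ⟨j, hj.symm⟩
        rcases hw w hlt.ne with h | h | h | h | h | h
        · rw [h, m1] at hlt; omega
        · rw [h, m2] at hlt; omega
        · rw [h, m3] at hlt; omega
        · exact Or.inr (Or.inl h)
        · exact Or.inr (Or.inr h)
        · exact Or.inl h
      · intro h
        have : R.move w < 0 := by rcases h with rfl | rfl | rfl <;> omega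
        obtain ⟨j, hj⟩ := hneg.1 this
        exact ⟨j, hj.symm⟩
    have hcard := congrArg Finset.card himg
    rw [Finset.card_image_of_injective _ R.v_injective, Finset.card_univ, Fintype.card_fin,
      Finset.card_eq_three.2 ⟨_, _, _, d64, d65, d45, rfl⟩] at hcard
    exact hcard
  · intro i
    have h := R.move_u i
    have hp := R.α_pos i
    have := val (R.u i) (by omega)
    omega

end ImsetRelation

/-! ### Case analysis on the pairs of directions -/

lemma exists_eq_pair_of_mem {N : Type*} [DecidableEq N] {p : Finset N} {t : N} (hp : p.card = 2)
    (ht : t ∈ p) : ∃ x, t ≠ x ∧ p = {t, x} := by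
  obtain ⟨x, y, hxy, rfl⟩ := Finset.card_eq_two.1 hp
  simp at ht
  rcases ht with rfl | rfl
  · exact ⟨y, hxy, rfl⟩
  · exact ⟨x, hxy.symm, Finset.pair_comm _ _⟩

theorem mainTheorem5 {N : Type*} [Finite N] [DecidableEq N] {m : ℕ} (R : ImsetRelation N 3 m) :
    (m = 3 ∧ (∃ c : ℤ, (∀ i, R.α i = c) ∧ (∀ j, R.β j = c)) ∧ R.IsMultipleOfThreeByThree) ∨
      ∃ R' : ImsetRelation N 2 2, R'.IsMultipleOfTwoByTwo ∧ R.Contains R' := by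
  choose p T hp hT hu using fun i => isElementaryImset_iff.1 (R.u_elementary i)
  by_cases hst : ∃ i j, Stacked (p i) (T i) (p j) (T j)
  · right
    obtain ⟨i, j, a, b, c, hab, hac, hbc, hpi, hpj, hs, hc, hTj⟩ := hst
    rw [hpi] at hs
    obtain ⟨R', h, h0, h1⟩ := ImsetRelation.exists_twoByTwo hab hac hbc (hs (by simp))
      (hs (by simp)) hc
    refine ⟨R', h, Or.inl fun i' => ?_⟩
    fin_cases i'
    · exact ⟨i, by rw [hu, hpi]; exact h0.symm⟩
    · exact ⟨j, by rw [hu, hpj, hTj]; exact h1.symm⟩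
  left
  push Not at hst
  have hsupp : ∀ q W, R.move (squareImset q W) ≠ 0 → q ⊆ W := fun q W h => R.zero_of_not_subset h
  have hmem : ∀ q W : Finset N, q.card = 2 → R.move (squareImset q W) ≠ 0 → ∃ i, p i = q :=
    fun q W hq h => R.exists_pair_eq hp hT hu hq h
  have hposT : ∀ i, 0 < R.move (squareImset (p i) (T i)) := fun i =>
    R.move_pos_iff.2 ⟨i, (hu i).symm⟩
  have cover : ∀ i j k l : Fin 3, i ≠ j → i ≠ k → j ≠ k → l = i ∨ l = j ∨ l = k := by decide
  have hTne : ∀ i j, i ≠ j → p i = p j → T i ≠ T j := by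
    intro i j hij h1 h2
    exact hij (R.u_injective (by rw [hu, hu, h1, h2]))
  by_cases hinj : Function.Injective p
  swap
  · exfalso
    rw [Function.Injective] at hinj
    push Not at hinj
    obtain ⟨i, j, hpij, hij⟩ := hinj
    obtain ⟨k, hik, hjk⟩ : ∃ k, i ≠ k ∧ j ≠ k := by
      clear * -; revert i j; decide
    -- Either all three pairs coincide and the equation at `T i` reads `0 < 0`, or `p k` has one
    -- positive coefficient and `p i` has two.
    by_cases hpk : p k = p i
    · have hz := R.sum_squareTerm_eq_zero (P := {p i}) (by simp [hp]) (by
        intro q W hq h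
        obtain ⟨l, rfl⟩ := hmem q W hq h
        rcases cover i j k l hij hik hjk with rfl | rfl | rfl
        · simp
        · simp [hpij]
        · simp [hpk]) (T i)
      rw [Finset.sum_singleton, squareTerm_of_subset _ (hT i)] at hz
      exact (hposT i).ne' hz
    · have hz := R.sum_squareTerm_eq_zero (P := {p k, p i}) (by simp [hp]) (by
        intro q W hq h
        obtain ⟨l, rfl⟩ := hmem q W hq h
        rcases cover i j k l hij hik hjk with rfl | rfl | rfl
        · simp
        · simp [hpij]
        · simp)
      refine false_of_two_pairs (hp k) (hp i) hpk
        (fun A => by have := hz A; rwa [Finset.sum_pair hpk] at this) (hsupp _) (hsupp _)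
        (T₁ := T k) (fun W => ⟨fun h => ?_, fun h => h ▸ hposT k⟩) (hposT i)
        (by rw [hpij]; exact hposT j) (hTne i j hij hpij)
      obtain ⟨l, hl⟩ := R.move_pos_iff.1 h
      rw [hu] at hl
      obtain ⟨h1, h2⟩ := squareImset_injective (hp k) (hp l) (hsupp _ _ h.ne') (hT l) hl
      rcases cover i j k l hij hik hjk with rfl | rfl | rfl
      · exact absurd h1 hpk
      · exact absurd (h1.trans hpij.symm) hpk
      · exact h2
  have hpos : ∀ i W, 0 < R.move (squareImset (p i) W) ↔ W = T i := by
    intro i W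
    refine ⟨fun h => ?_, fun h => h ▸ hposT i⟩
    obtain ⟨l, hl⟩ := R.move_pos_iff.1 h
    rw [hu] at hl
    obtain ⟨h1, h2⟩ := squareImset_injective (hp i) (hp l) (hsupp _ _ h.ne') (hT l) hl
    rw [hinj h1]; exact h2
  have hsum : ∀ i j k, i ≠ j → i ≠ k → j ≠ k → ∀ A,
      squareTerm (p i) (fun W => R.move (squareImset (p i) W)) A +
      squareTerm (p j) (fun W => R.move (squareImset (p j) W)) A +
      squareTerm (p k) (fun W => R.move (squareImset (p k) W)) A = 0 := by
    intro i j k hij hik hjk A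
    have hz := R.sum_squareTerm_eq_zero (P := {p i, p j, p k}) (by simp [hp]) (by
      intro q W hq h
      obtain ⟨l, rfl⟩ := hmem q W hq h
      rcases cover i j k l hij hik hjk with rfl | rfl | rfl <;> simp) A
    rw [Finset.sum_insert (by simp [hinj.ne hij, hinj.ne hik]), Finset.sum_pair (hinj.ne hjk)] at hz
    linarith
  have iso : ∀ i j k, i ≠ j → i ≠ k → j ≠ k → Disjoint (p i) (p j) → ¬Disjoint (p i) (p k) :=
    fun i j k hij hik hjk h1 h2 => false_of_isolated (hp j) (hp k) h1 h2 (hinj.ne hjk)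
      (hsum i j k hij hik hjk) (hsupp _) (hpos i)
  -- If two pairs are disjoint, the third meets both, as neither is isolated.
  obtain ⟨i, j, k, hij, hik, hjk, hdj, hdk⟩ : ∃ i j k, i ≠ j ∧ i ≠ k ∧ j ≠ k ∧
      ¬Disjoint (p i) (p j) ∧ ¬Disjoint (p i) (p k) := by
    by_cases h01 : Disjoint (p 0) (p 1)
    · refine ⟨2, 0, 1, by decide, by decide, by decide, fun h => ?_, fun h => ?_⟩
      · exact iso 0 1 2 (by decide) (by decide) (by decide) h01 h.symm
      · exact iso 1 0 2 (by decide) (by decide) (by decide) h01.symm h.symm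
    · by_cases h02 : Disjoint (p 0) (p 2)
      · refine ⟨1, 0, 2, by decide, by decide, by decide, fun h => h01 h.symm, fun h => ?_⟩
        exact iso 2 0 1 (by decide) (by decide) (by decide) h02.symm h.symm
      · exact ⟨0, 1, 2, by decide, by decide, by decide, h01, h02⟩
  rw [Finset.not_disjoint_iff] at hdj hdk
  obtain ⟨a, hai, haj⟩ := hdj
  obtain ⟨b, hbi, hbk⟩ := hdk
  have hsm := hsum i j k hij hik hjk
  have nij := hinj.ne hij
  have nik := hinj.ne hik
  have njk := hinj.ne hjk
  have pi := hpos i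
  have pj := hpos j
  have pk := hpos k
  obtain ⟨x, hax, hpj⟩ := exists_eq_pair_of_mem (hp j) haj
  -- A common point gives the star; different meeting points give a path, possibly closed to a
  -- triangle by `x = y`.
  by_cases hab : a = b
  · subst hab
    obtain ⟨z, haz, hpi⟩ := exists_eq_pair_of_mem (hp i) hai
    obtain ⟨y, hay, hpk⟩ := exists_eq_pair_of_mem (hp k) hbk
    have sij := hst i j
    have sji := hst j i
    have sik := hst i k
    have ski := hst k i
    have sjk := hst j k
    have skj := hst k j
    rw [hpi] at pi sij sji sik ski nij nik
    rw [hpj] at pj sij sji sjk skj nij njk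
    rw [hpk] at pk sik ski sjk skj nik njk
    rw [hpi, hpj, hpk] at hsm
    have hzx : z ≠ x := by rintro rfl; exact nij rfl
    have hzy : z ≠ y := by rintro rfl; exact nik rfl
    have hxy : x ≠ y := by rintro rfl; exact njk rfl
    obtain ⟨E, s, hs, haE, hzE, hxE, hyE, ⟨u1, u2, u3⟩, ⟨v1, v2, v3⟩, ⟨w1, w2, w3⟩⟩ :=
      star_coefficients haz hax hay hzx hzy hxy hsm (hsupp _) (hsupp _) (hsupp _) pi pj pk
        sij sji sik ski sjk skj
    have six : ∀ w, R.move w ≠ 0 → w = squareImset {a, z} (insert z (insert x E)) ∨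
        w = squareImset {a, z} (insert z (insert y E)) ∨
        w = squareImset {a, x} (insert x (insert y E)) ∨
        w = squareImset {a, x} (insert x (insert z E)) ∨
        w = squareImset {a, y} (insert y (insert z E)) ∨
        w = squareImset {a, y} (insert y (insert x E)) := by
      intro w hw
      obtain ⟨q, W, hq, _, rfl⟩ := isElementaryImset_iff.1 (R.isElementaryImset_of_move_ne_zero hw)
      obtain ⟨l, rfl⟩ := hmem q W hq hw
      rcases cover i j k l hij hik hjk with rfl | rfl | rfl
      · rw [hpi] at hw ⊢
        rcases u3 W hw with rfl | rfl <;> simp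
      · rw [hpj] at hw ⊢
        rcases v3 W hw with rfl | rfl <;> simp
      · rw [hpk] at hw ⊢
        rcases w3 W hw with rfl | rfl <;> simp
    -- A negative parameter exchanges the two sides of the cyclic relation, which amounts to
    -- swapping `x` and `y`.
    rcases lt_or_gt_of_ne hs with hneg | hgt
    · exact R.threeByThree_of_move (s := -s) (by omega) haz hay hax hzy hzx hxy.symm haE hzE hyE hxE
        u2 w2 v2 (by rw [w1, neg_neg]) (by rw [v1, neg_neg]) (by rw [u1, neg_neg])
        (fun w hw => by have := six w hw; tauto)
    · exact R.threeByThree_of_move hgt haz hax hay hzx hzy hxy haE hzE hxE hyE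
        u1 v1 w1 v2 w2 u2 (fun w hw => by have := six w hw; tauto)
  · exfalso
    obtain ⟨y, hby, hpk⟩ := exists_eq_pair_of_mem (hp k) hbk
    have hpi : p i = {a, b} := by
      refine (Finset.eq_of_subset_of_card_le ?_ (by rw [hp i, Finset.card_pair hab])).symm
      intro t; simp; rintro (rfl | rfl) <;> assumption
    have sij := hst i j
    have sji := hst j i
    have sik := hst i k
    have ski := hst k i
    rw [hpi] at pi sij sji sik ski nij nik
    rw [hpj] at pj sij sji nij
    rw [hpk] at pk sik ski nik
    rw [hpi, hpj, hpk] at hsm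
    have hbx : b ≠ x := by rintro rfl; exact nij rfl
    have hay : a ≠ y := by rintro rfl; exact nik (Finset.pair_comm _ _)
    rcases stacked_of_path hab hax hbx hby hay hsm (hsupp _) (hsupp _) (hsupp _) pi pj pk with
      (h | h) | (h | h)
    · exact sij h
    · exact sji h
    · exact sik h
    · exact ski h
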